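/- **Lemma (De Giorgi type inequality).** Let $1<p<q<\infty$ and $K\ge 1$. There is a constant $C>0$, depending only on $K$ and the exponents $p,q$, such that the following holds. Let $(X,d)$ be a complete metric space with a doubling Borel regular measure $\mu$ (there is $C_d\ge1$ with $0<\mu(B(y,2r))\le C_d\,\mu(B(y,r))<\infty$ for all $y\in X$, $r>0$), let $\Omega\subset X$ be a non-empty open set with $\mu(X\setminus\Omega)>0$, and let $a,b:X\to\mathbb R$ be measurable with $0<\alpha\le a,b\le\beta$ for some constants $\alpha,\beta$. For an open set $A\subset X$ (regarded as a metric measure space with the restrictions of $d$ and $\mu$), a Borel function $g\ge 0$ is a $q$-weak upper gradient of $u:A\to[-\infty,\infty]$ in $A$ if, for all non-constant compact rectifiable paths $\gamma$ in $A$ outside a family of zero $q$-modulus, with end points $x,z$, one has $|u(x)-u(z)|\le\int_\gamma g\,ds$ if $u(x),u(z)$ are finite, and $\int_\gamma g\,ds=\infty$ otherwise. $L^q_{loc}(A)$ consists of the functions that are $q$-integrable near every point of $A$. The minimal $q$-weak upper gradient $g_u$ of $u$ in $A$ is the $\mu$-a.e. smallest one among the $q$-weak upper gradients of $u$ in $L^q_{loc}(A)$.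 $N^{1,q}(A)$ (respectively $N^{1,q}_{loc}(A)$) is the set of measurable $u:A\to[-\infty,\infty]$ in $L^q(A)$ (respectively $L^q_{loc}(A)$) that have a $q$-weak upper gradient in $L^q(A)$ (respectively $L^q_{loc}(A)$), and $N^{1,q}_0(A)$ is the set of functions on $A$ whose extension by zero to $X\setminus A$ belongs to $N^{1,q}(X)$. Let $u\in N^{1,q}_{loc}(\Omega)$ be a $(p,q)$-quasiminimizer on $\Omega$ with constant $K$, that is, $$\int_{\Omega'}a g_u^p\,d\mu+\int_{\Omega'}b g_u^q\,d\mu\le K\Big(\int_{\Omega'}a g_v^p\,d\mu+\int_{\Omega'}b g_v^q\,d\mu\Big)$$ for every bounded open $\Omega'$ with $\overline{\Omega'}\subset\Omega$ and every $v\in N^{1,q}(\Omega')$ with $u-v\in N^{1,q}_0(\Omega')$, where $g_u$, $g_v$ are the minimal $q$-weak upper gradients of $u$ in $\Omega$ and of $v$ in $\Omega'$. Let $y\in\Omega$, $R(y)=\tfrac12 d(y,X\setminus\Omega)$, and $S_{k,r}=\{x\in B(y,r)\cap\Omega: u(x)>k\}$. Then, for all $0<\rho<R<R(y)$ and all $k\in\mathbb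 R$, $$\int_{S_{k,\rho}}(a g_u^p+b g_u^q)\,d\mu\le C\left(\frac1{(R-\rho)^p}\int_{S_{k,R}}a(u-k)^p\,d\mu+\frac1{(R-\rho)^q}\int_{S_{k,R}}b(u-k)^q\,d\mu\right).$$ -/

import Mathlib

open Set Filter Topology MeasureTheory
open scoped ENNReal NNReal

noncomputable section

/-- A measure on a metric space is doubling if, for some constant `C ≥ 1`, every ball satisfies
`0 < μ (B(y, 2r)) ≤ C μ (B(y, r)) < ∞`. -/
def DoublingMeasure {X : Type*} [MetricSpace X] [MeasurableSpace X] (μ : Measure X) : Prop :=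
  ∃ C : ℝ≥0, 1 ≤ C ∧ ∀ (y : X) (r : ℝ), 0 < r →
    0 < μ (Metric.ball y (2 * r)) ∧
    μ (Metric.ball y (2 * r)) ≤ (C : ℝ≥0∞) * μ (Metric.ball y r) ∧
    μ (Metric.ball y r) < ⊤

/-- A non-constant compact rectifiable path, parametrized by arc length on `[0, len]`
(the values of `toFun` outside `[0, len]` are never used). -/
structure ArcPath (X : Type*) [MetricSpace X] where
  len : ℝ
  len_pos : 0 < len
  toFun : ℝ → X
  unitSpeed : HasUnitSpeedOn toFun (Icc 0 len)

/-- The path lies in the set `A`. -/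
def ArcPath.LiesIn {X : Type*} [MetricSpace X] (γ : ArcPath X) (A : Set X) : Prop :=
  MapsTo γ.toFun (Icc 0 γ.len) A

/-- The line integral `∫_γ g ds`. -/
def ArcPath.lineIntegral {X : Type*} [MetricSpace X] (γ : ArcPath X) (g : X → ℝ≥0∞) : ℝ≥0∞ :=
  ∫⁻ t in Icc 0 γ.len, g (γ.toFun t)

/-- The `q`-modulus of a family of paths: the infimum of `∫ ρ^q dν` over all non-negative Borel
functions `ρ` with `∫_γ ρ ds ≥ 1` for all `γ` in the family. -/
def pathModulus {X : Type*} [MetricSpace X] [MeasurableSpace X] (q : ℝ) (ν : Measure X)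
    (Γ : Set (ArcPath X)) : ℝ≥0∞ :=
  ⨅ (ρ : X → ℝ≥0∞) (_ : Measurable ρ) (_ : ∀ γ ∈ Γ, 1 ≤ γ.lineIntegral ρ),
    ∫⁻ x, ρ x ^ q ∂ν

/-- The upper gradient inequality for `u` and `g` along `γ`, with end points `x`, `z`:
`|u(x) - u(z)| ≤ ∫_γ g ds` if `u(x)`, `u(z)` are both finite, and `∫_γ g ds = ∞` otherwise. -/
def UpperGradientIneq {X : Type*} [MetricSpace X] (u : X → EReal) (g : X → ℝ≥0∞)
    (γ : ArcPath X) : Prop :=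
  ((u (γ.toFun 0)).abs < ⊤ ∧ (u (γ.toFun γ.len)).abs < ⊤ →
    (u (γ.toFun 0) - u (γ.toFun γ.len)).abs ≤ γ.lineIntegral g) ∧
  (¬((u (γ.toFun 0)).abs < ⊤ ∧ (u (γ.toFun γ.len)).abs < ⊤) → γ.lineIntegral g = ⊤)

/-- `g` is a `q`-weak upper gradient of `u` in the (open) set `A`, where `A` is regarded as a metric
measure space in its own right with the restricted distance and measure: the inequality
holds for all paths in `A` outside a family of zero `q`-modulus. -/
def IsWeakUpperGradient {X : Type*} [MetricSpace X] [MeasurableSpace X] (q : ℝ) (μ : Measure X)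
    (A : Set X) (u : X → EReal) (g : X → ℝ≥0∞) : Prop :=
  Measurable g ∧
    pathModulus q (μ.restrict A) {γ | γ.LiesIn A ∧ ¬ UpperGradientIneq u g γ} = 0

/-- `f ^ q` is integrable over a neighbourhood (in `A`) of every point of `A`. -/
def LocallyLq {X : Type*} [MetricSpace X] [MeasurableSpace X] (q : ℝ) (μ : Measure X)
    (A : Set X) (f : X → ℝ≥0∞) : Prop :=
  ∀ x ∈ A, ∃ r : ℝ, 0 < r ∧ ∫⁻ z in Metric.ball x r ∩ A, f z ^ q ∂μ < ⊤

/-- `g` is the minimal `q`-weak upper gradient of `u` in `A` (unique up to null sets): it is the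
a.e. smallest one among the `q`-weak upper gradients that are locally `q`-integrable in `A`. -/
def IsMinimalWeakUpperGradient {X : Type*} [MetricSpace X] [MeasurableSpace X] (q : ℝ)
    (μ : Measure X) (A : Set X) (u : X → EReal) (g : X → ℝ≥0∞) : Prop :=
  IsWeakUpperGradient q μ A u g ∧ LocallyLq q μ A g ∧
    ∀ h : X → ℝ≥0∞, IsWeakUpperGradient q μ A u h → LocallyLq q μ A h →
      ∀ᵐ x ∂(μ.restrict A), g x ≤ h x

/-- The Newtonian space `N^{1,q}(A)`. Its elements are extended real-valued functions, defined at
every point of `A`; values outside `A` are irrelevant. -/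
def MemNewtonian {X : Type*} [MetricSpace X] [MeasurableSpace X] (q : ℝ) (μ : Measure X)
    (A : Set X) (u : X → EReal) : Prop :=
  AEMeasurable u (μ.restrict A) ∧ ∫⁻ x in A, (u x).abs ^ q ∂μ < ⊤ ∧
    ∃ g : X → ℝ≥0∞, IsWeakUpperGradient q μ A u g ∧ ∫⁻ x in A, g x ^ q ∂μ < ⊤

/-- The local Newtonian space `N^{1,q}_loc(A)`. -/
def MemNewtonianLoc {X : Type*} [MetricSpace X] [MeasurableSpace X] (q : ℝ) (μ : Measure X)
    (A : Set X) (u : X → EReal) : Prop :=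
  AEMeasurable u (μ.restrict A) ∧ LocallyLq q μ A (fun x => (u x).abs) ∧
    ∃ g : X → ℝ≥0∞, IsWeakUpperGradient q μ A u g ∧ LocallyLq q μ A g

open Classical in
/-- The Newtonian space with zero boundary values `N^{1,q}_0(A)`: the extension of `u` by zero
to the whole space belongs to `N^{1,q}(X)`. -/
def MemNewtonianZero {X : Type*} [MetricSpace X] [MeasurableSpace X] (q : ℝ) (μ : Measure X)
    (A : Set X) (u : X → EReal) : Prop :=
  MemNewtonian q μ univ (fun x => if x ∈ A then u x else 0)

/-- The energy `∫_A a g^p dμ + ∫_A b g^q dμ`. -/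
def pqEnergy {X : Type*} [MeasurableSpace X] (p q : ℝ) (μ : Measure X) (a b : X → ℝ)
    (A : Set X) (g : X → ℝ≥0∞) : ℝ≥0∞ :=
  ∫⁻ x in A, ENNReal.ofReal (a x) * g x ^ p ∂μ + ∫⁻ x in A, ENNReal.ofReal (b x) * g x ^ q ∂μ

/-- `u` is a `(p,q)`-quasiminimizer on `Ω` with constant `K`. In `u - v`, the value of `∞ - ∞` is
immaterial: functions in the Newtonian spaces are finite almost everywhere and along almost every
path. -/
def IsQuasiminimizer {X : Type*} [MetricSpace X] [MeasurableSpace X] (p q K : ℝ) (μ : Measure X)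
    (a b : X → ℝ) (Ω : Set X) (u : X → EReal) : Prop :=
  MemNewtonianLoc q μ Ω u ∧
    ∀ Ω' : Set X, IsOpen Ω' → Bornology.IsBounded Ω' → closure Ω' ⊆ Ω →
    ∀ v : X → EReal, MemNewtonian q μ Ω' v → MemNewtonianZero q μ Ω' (fun x => u x - v x) →
    ∀ gu gv : X → ℝ≥0∞, IsMinimalWeakUpperGradient q μ Ω u gu →
      IsMinimalWeakUpperGradient q μ Ω' v gv →
      pqEnergy p q μ a b Ω' gu ≤ ENNReal.ofReal K * pqEnergy p q μ a b Ω' gv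

/-- The superlevel set `S_{k,r} = {x ∈ B(y,r) ∩ Ω : u(x) > k}`. -/
def superlevelSet {X : Type*} [MetricSpace X] (Ω : Set X) (u : X → EReal) (y : X) (k r : ℝ) :
    Set X :=
  {x | x ∈ Metric.ball y r ∩ Ω ∧ (k : EReal) < u x}

end

/-! The proof is Caccioppoli's argument, hole filling and absorption. For `t < s` let `η` be a
cutoff, 1 on `B(y,t)`, 0 off `B(y,s)` and `1/(s-t)`-Lipschitz, and test quasiminimality with `v = u
- η (u-k)₊`. The product rule along almost every path shows that on `{u > k}` the function `(1-η)
g_u + (u-k)/(s-t)` is a weak upper gradient of `v`. Its first term vanishes on `B(y,t)`, so with `M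
= K 2^q` the energy of `u` on `S_{k,t}` is at most `M` times the energy on `S_{k,s} \ S_{k,t}` plus
the terms in `u-k`. Adding `M` times the energy on `S_{k,t}` to both sides
(`IsQuasiminimizer.hole_filling`) leaves the factor `θ = M/(1+M) < 1` in front of the energy on
`S_{k,s}`. The iteration lemma `exists_const_of_absorption` absorbs that term, with a constant that
depends only on `θ`, `p` and `q`.

Three points need care. Quasiminimality concerns open sets, and `{u > k}` need not be open:
`IsQuasiminimizer.lintegral_pqDensity_le_truncation` tests on open sets containing it in the ball
and shrinks them by outer regularity. The definition speaks of the minimal gradient of `v`, whose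
existence is `exists_isMinimalWeakUpperGradient`. Finally, `u - v` must have zero boundary values,
which involves paths that leave `Ω`: `IsWeakUpperGradient.zeroExtension_truncation`.

All gradient calculus is done on single paths: outside a family of zero modulus an upper gradient
inequality holds on every subpath in the set, and is then equivalent to absolute continuity with a
pointwise bound on the derivative. -/

/-! ### Absolutely continuous functions of one variable. -/

theorem AbsolutelyContinuousOnInterval.of_dist_le {f g : ℝ → ℝ} {a b : ℝ}
    (hg : AbsolutelyContinuousOnInterval g a b)
    (h : ∀ x ∈ uIcc a b, ∀ y ∈ uIcc a b, dist (f x) (f y) ≤ dist (g x) (g y)) :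
    AbsolutelyContinuousOnInterval f a b := by
  refine squeeze_zero' (Eventually.of_forall fun E => Finset.sum_nonneg fun _ _ => dist_nonneg) ?_ hg
  refine eventually_inf_principal.2 (Eventually.of_forall fun E hE => ?_)
  exact Finset.sum_le_sum fun i hi => h _ (hE.1 i hi).1 _ (hE.1 i hi).2

theorem abs_deriv_le_of_abs_sub_le {f P : ℝ → ℝ} {L t P' : ℝ} (ht : t ∈ Ioo 0 L)
    (hf : DifferentiableAt ℝ f t) (hP : HasDerivAt P P' t)
    (h : ∀ x y, 0 ≤ x → x ≤ y → y ≤ L → |f x - f y| ≤ P y - P x) : |deriv f t| ≤ P' := by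
  have h1 := (hasDerivAt_iff_tendsto_slope.1 hf.hasDerivAt).abs
  have h2 := hasDerivAt_iff_tendsto_slope.1 hP
  refine le_of_tendsto_of_tendsto h1 h2 ?_
  have : ∀ᶠ y in 𝓝[≠] t, y ∈ Ioo 0 L :=
    mem_nhdsWithin_of_mem_nhds (isOpen_Ioo.mem_nhds ht)
  filter_upwards [this, self_mem_nhdsWithin] with y hy hne
  rw [slope_def_field, slope_def_field, abs_div]
  rcases lt_or_gt_of_ne hne with hlt | hgt
  · have := h y t hy.1.le hlt.le ht.2.le
    rw [abs_of_neg (sub_neg.2 hlt), ← neg_div_neg_eq (P y - P t)]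
    gcongr
    · linarith
    · linarith
  · have := h t y ht.1.le (le_of_lt hgt) hy.2.le
    have h0 : 0 < y - t := sub_pos.2 hgt
    rw [abs_of_pos h0, abs_sub_comm]
    gcongr

/-- The primitive of `G` dominates the increments of `f`, so `f` inherits its absolute continuity,
and Lebesgue differentiation of the primitive bounds the derivative. This turns an integral
inequality on all subintervals into a pointwise one. -/
theorem absolutelyContinuousOnInterval_and_abs_deriv_le {f : ℝ → ℝ} {G : ℝ → ℝ≥0∞} {L : ℝ}
    (hL : 0 ≤ L) (hG : AEMeasurable G (volume.restrict (Icc 0 L)))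
    (hfin : ∫⁻ t in Icc 0 L, G t ≠ ⊤)
    (hf : ∀ x y, 0 ≤ x → x ≤ y → y ≤ L → ENNReal.ofReal |f x - f y| ≤ ∫⁻ t in Icc x y, G t) :
    AbsolutelyContinuousOnInterval f 0 L ∧
      ∀ᵐ t, t ∈ Ioo 0 L → ENNReal.ofReal |deriv f t| ≤ G t := by
  have hint : IntegrableOn (fun t => (G t).toReal) (Icc 0 L) :=
    integrable_toReal_of_lintegral_ne_top hG hfin
  have hii : ∀ x y, 0 ≤ x → x ≤ y → y ≤ L →
      IntervalIntegrable (fun t => (G t).toReal) volume x y := fun x y h0 hxy hy =>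
    (intervalIntegrable_iff_integrableOn_Icc_of_le hxy).2 (hint.mono_set (Icc_subset_Icc h0 hy))
  have hP : ∀ x y, 0 ≤ x → x ≤ y → y ≤ L →
      |f x - f y| ≤ (∫ t in (0 : ℝ)..y, (G t).toReal) - ∫ t in (0 : ℝ)..x, (G t).toReal := by
    intro x y h0 hxy hy
    rw [intervalIntegral.integral_interval_sub_left (hii 0 y le_rfl (h0.trans hxy) hy)
      (hii 0 x le_rfl h0 (hxy.trans hy)), intervalIntegral.integral_of_le hxy,
      ← integral_Icc_eq_integral_Ioc]
    have hs : Icc x y ⊆ Icc 0 L := Icc_subset_Icc h0 hy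
    have hfin' : ∫⁻ t in Icc x y, G t ≠ ⊤ :=
      ne_top_of_le_ne_top hfin (lintegral_mono_set hs)
    have hG' : AEMeasurable G (volume.restrict (Icc x y)) := hG.mono_set hs
    rw [integral_toReal hG' (ae_lt_top' hG' hfin')]
    exact (ENNReal.ofReal_le_iff_le_toReal hfin').1 (hf x y h0 hxy hy)
  have hAC : AbsolutelyContinuousOnInterval f 0 L := by
    refine ((hii 0 L le_rfl hL le_rfl).absolutelyContinuousOnInterval_intervalIntegral
      left_mem_uIcc).of_dist_le ?_
    rw [uIcc_of_le hL]
    have key : ∀ x ∈ Icc 0 L, ∀ y ∈ Icc 0 L, x ≤ y → dist (f x) (f y) ≤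
        dist (∫ t in (0 : ℝ)..x, (G t).toReal) (∫ t in (0 : ℝ)..y, (G t).toReal) := by
      intro x hx y hy hxy
      rw [Real.dist_eq, Real.dist_eq, abs_sub_comm (intervalIntegral _ _ _ _)]
      exact (hP x y hx.1 hxy hy.2).trans (le_abs_self _)
    intro x hx y hy
    rcases le_total x y with hxy | hxy
    · exact key x hx y hy hxy
    · rw [dist_comm, dist_comm (intervalIntegral _ _ _ _)]
      exact key y hy x hx hxy
  refine ⟨hAC, ?_⟩
  filter_upwards [hAC.ae_differentiableAt,
    (hii 0 L le_rfl hL le_rfl).ae_hasDerivAt_integral] with t h1 h2 ht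
  have ht' : t ∈ uIcc 0 L := by
    rw [uIcc_of_le hL]; exact Ioo_subset_Icc_self ht
  have := abs_deriv_le_of_abs_sub_le ht (h1 ht') (h2 ht' 0 left_mem_uIcc) hP
  exact (ENNReal.ofReal_le_ofReal this).trans ENNReal.ofReal_toReal_le

/-- The way back, by the fundamental theorem of calculus: derivative bounds can be combined
pointwise and then integrated. -/
theorem AbsolutelyContinuousOnInterval.ofReal_abs_sub_le_lintegral {w : ℝ → ℝ} {H : ℝ → ℝ≥0∞}
    {L : ℝ} (hL : 0 ≤ L) (hw : AbsolutelyContinuousOnInterval w 0 L)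
    (h : ∀ᵐ t, t ∈ Ioo 0 L → ENNReal.ofReal |deriv w t| ≤ H t) :
    ENNReal.ofReal |w 0 - w L| ≤ ∫⁻ t in Icc 0 L, H t := by
  rw [abs_sub_comm, ← hw.integral_deriv_eq_sub, intervalIntegral.integral_of_le hL,
    ← Real.enorm_eq_ofReal_abs]
  refine (enorm_integral_le_lintegral_enorm _).trans ?_
  rw [setLIntegral_congr Ioo_ae_eq_Ioc.symm, setLIntegral_congr (Ioo_ae_eq_Icc (a := (0 : ℝ))).symm]
  refine setLIntegral_mono_ae' measurableSet_Ioo ?_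
  filter_upwards [h] with t ht hmem
  rw [Real.enorm_eq_ofReal_abs]
  exact ht hmem

/-- The product rule behind the Caccioppoli inequality, along a single curve. -/
theorem ofReal_abs_deriv_truncation_le {f η : ℝ → ℝ} {G : ℝ → ℝ≥0∞} {L k c : ℝ} (hL : 0 ≤ L)
    (hf : AbsolutelyContinuousOnInterval f 0 L)
    (hfG : ∀ᵐ t, t ∈ Ioo 0 L → ENNReal.ofReal |deriv f t| ≤ G t)
    (hη1 : ∀ t, η t ≤ 1)
    (hη : ∀ x ∈ Icc 0 L, ∀ y ∈ Icc 0 L, |η x - η y| ≤ c * |x - y|) :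
    AbsolutelyContinuousOnInterval (fun t => f t - η t * max (f t - k) 0) 0 L ∧
    ∀ᵐ t, t ∈ Ioo 0 L →
      ENNReal.ofReal |deriv (fun t => f t - η t * max (f t - k) 0) t| ≤
        ENNReal.ofReal (1 - if k < f t then η t else 0) * G t
          + ENNReal.ofReal (c * max (f t - k) 0) := by
  have hηAC : AbsolutelyContinuousOnInterval η 0 L := by
    refine LipschitzOnWith.absolutelyContinuousOnInterval (K := c.toNNReal) ?_
    rw [uIcc_of_le hL]
    refine LipschitzOnWith.of_dist_le_mul fun x hx y hy => ?_
    rw [Real.dist_eq, Real.dist_eq]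
    refine (hη x hx y hy).trans ?_
    gcongr
    exact Real.le_coe_toNNReal c
  have hmAC : AbsolutelyContinuousOnInterval (fun t => max (f t - k) 0) 0 L := by
    refine hf.of_dist_le fun x _ y _ => ?_
    rw [Real.dist_eq, Real.dist_eq]
    refine (abs_max_sub_max_le_abs _ _ _).trans (le_of_eq ?_)
    ring_nf
  have hηd : ∀ t ∈ Ioo 0 L, DifferentiableAt ℝ η t → |deriv η t| ≤ c := by
    intro t ht hd
    have hP : HasDerivAt (fun x : ℝ => c * x) c t := by
      simpa using (hasDerivAt_id t).const_mul c
    refine abs_deriv_le_of_abs_sub_le ht hd hP fun x y h0 hxy hy => ?_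
    refine (hη x ⟨h0, hxy.trans hy⟩ y ⟨h0.trans hxy, hy⟩).trans (le_of_eq ?_)
    rw [abs_of_nonpos (by linarith)]
    ring
  refine ⟨hf.sub (hηAC.mul hmAC), ?_⟩
  filter_upwards [hf.ae_differentiableAt, hηAC.ae_differentiableAt, hmAC.ae_differentiableAt, hfG]
    with t hfd hηd' hmd hG ht
  have ht' : t ∈ uIcc 0 L := by
    rw [uIcc_of_le hL]; exact Ioo_subset_Icc_self ht
  specialize hfd ht'
  specialize hηd' ht'
  specialize hmd ht'
  specialize hG ht
  have hd : deriv (fun t => f t - η t * max (f t - k) 0) t =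
      deriv f t - (deriv η t * max (f t - k) 0 + η t * deriv (fun t => max (f t - k) 0) t) :=
    (hfd.hasDerivAt.sub (hηd'.hasDerivAt.mul hmd.hasDerivAt)).deriv
  have hm0 : 0 ≤ max (f t - k) 0 := le_max_right _ _
  have hc : |deriv η t * max (f t - k) 0| ≤ c * max (f t - k) 0 := by
    rw [abs_mul, abs_of_nonneg hm0]
    exact mul_le_mul_of_nonneg_right (hηd t ht hηd') hm0
  have hmain : |deriv (fun t => f t - η t * max (f t - k) 0) t| ≤
      (1 - if k < f t then η t else 0) * |deriv f t| + c * max (f t - k) 0 := by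
    rw [hd]
    split_ifs with hk
    · have hev : (fun t => max (f t - k) 0) =ᶠ[𝓝 t] fun t => f t - k := by
        filter_upwards [hfd.continuousAt.eventually (lt_mem_nhds hk)] with s hs
        exact max_eq_left (by linarith)
      rw [hev.deriv_eq, deriv_sub_const]
      calc _ = |(1 - η t) * deriv f t - deriv η t * max (f t - k) 0| := by congr 1; ring
        _ ≤ _ := by
          refine (abs_sub _ _).trans ?_
          rw [abs_mul, abs_of_nonneg (sub_nonneg.2 (hη1 t))]
          gcongr
    -- Where `f t ≤ k` the positive part attains its least value 0, so its derivative vanishes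
    -- there, without any case distinction at `f t = k`.
    · have hmin : IsLocalMin (fun t => max (f t - k) 0) t := by
        refine Eventually.of_forall fun s => ?_
        have : max (f t - k) 0 = 0 := max_eq_right (by linarith)
        simp only [this]
        exact le_max_right _ _
      rw [hmin.deriv_eq_zero, mul_zero, add_zero, sub_zero, one_mul]
      exact (abs_sub _ _).trans (by gcongr)
  have h1 : 0 ≤ 1 - if k < f t then η t else 0 := by
    split_ifs
    · linarith [hη1 t]
    · norm_num
  refine (ENNReal.ofReal_le_ofReal hmain).trans (ENNReal.ofReal_add_le.trans ?_)
  rw [ENNReal.ofReal_mul h1]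
  gcongr

/-! ### Paths, null families and good paths. -/

section Modulus

variable {X : Type*} [MetricSpace X]

theorem ArcPath.lipschitz (γ : ArcPath X) {x y : ℝ} (hx : x ∈ Icc 0 γ.len)
    (hy : y ∈ Icc 0 γ.len) : dist (γ.toFun x) (γ.toFun y) ≤ |x - y| := by
  have key : ∀ x ∈ Icc 0 γ.len, ∀ y ∈ Icc 0 γ.len, x ≤ y →
      dist (γ.toFun x) (γ.toFun y) ≤ |x - y| := by
    intro x hx y hy hxy
    have h1 := eVariationOn.edist_le γ.toFun (s := Icc 0 γ.len ∩ Icc x y)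
      ⟨hx, le_rfl, hxy⟩ ⟨hy, hxy, le_rfl⟩
    rw [γ.unitSpeed hx hy, edist_dist, NNReal.coe_one, one_mul,
      ENNReal.ofReal_le_ofReal_iff (sub_nonneg.2 hxy)] at h1
    rwa [abs_sub_comm, abs_of_nonneg (sub_nonneg.2 hxy)]
  rcases le_total x y with h | h
  · exact key x hx y hy h
  · rw [dist_comm, abs_sub_comm]
    exact key y hy x hx h

theorem ArcPath.continuousOn (γ : ArcPath X) : ContinuousOn γ.toFun (Icc 0 γ.len) := by
  have : LipschitzOnWith 1 γ.toFun (Icc 0 γ.len) :=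
    LipschitzOnWith.of_dist_le_mul fun x hx y hy => by
      simpa [Real.dist_eq] using γ.lipschitz hx hy
  exact this.continuousOn

/-- The restriction of a path to the parameter interval `[x, y]`. -/
def ArcPath.sub (γ : ArcPath X) (x y : ℝ) (hx : 0 ≤ x) (hxy : x < y) (hy : y ≤ γ.len) :
    ArcPath X where
  len := y - x
  len_pos := sub_pos.2 hxy
  toFun t := γ.toFun (t + x)
  unitSpeed := by
    intro s hs t ht
    have hmono : MonotoneOn (fun t : ℝ => t + x) (Icc 0 (y - x) ∩ Icc s t) :=
      fun a _ b _ hab => by simpa using hab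
    have h1 := eVariationOn.comp_eq_of_monotoneOn γ.toFun _ hmono
    have himg : (fun t : ℝ => t + x) '' (Icc 0 (y - x) ∩ Icc s t) =
        Icc 0 γ.len ∩ Icc (s + x) (t + x) := by
      rw [Icc_inter_Icc, Icc_inter_Icc, image_add_const_Icc]
      obtain ⟨hs0, hs1⟩ := hs
      obtain ⟨ht0, ht1⟩ := ht
      rw [sup_eq_right.2 hs0, inf_eq_right.2 ht1, sup_eq_right.2 (by linarith),
        inf_eq_right.2 (by linarith)]
    rw [himg] at h1
    refine h1.trans ?_
    rw [γ.unitSpeed (x := s + x) ⟨by linarith [hs.1], by linarith [hs.2]⟩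
      (y := t + x) ⟨by linarith [ht.1], by linarith [ht.2]⟩]
    ring_nf

theorem ArcPath.lineIntegral_sub (γ : ArcPath X) (g : X → ℝ≥0∞) {x y : ℝ} (hx : 0 ≤ x)
    (hxy : x < y) (hy : y ≤ γ.len) :
    (γ.sub x y hx hxy hy).lineIntegral g = ∫⁻ t in Icc x y, g (γ.toFun t) := by
  have h := (measurePreserving_add_right volume x).setLIntegral_comp_preimage_emb
    (MeasurableEquiv.addRight x).measurableEmbedding (fun t => g (γ.toFun t)) (Icc x y)
  have h2 : (fun t : ℝ => t + x) ⁻¹' Icc x y = Icc 0 (y - x) := by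
    rw [preimage_add_const_Icc, sub_self]
  rw [← h, h2]
  rfl

theorem EReal.coe_toReal_of_abs_lt_top {r : EReal} (h : r.abs < ⊤) : (r.toReal : EReal) = r := by
  induction r with
  | bot => simp at h
  | top => simp at h
  | coe r => simp

theorem EReal.abs_sub_eq_ofReal {r s : EReal} (hr : r.abs < ⊤) (hs : s.abs < ⊤) :
    (r - s).abs = ENNReal.ofReal |r.toReal - s.toReal| := by
  conv_lhs => rw [← EReal.coe_toReal_of_abs_lt_top hr, ← EReal.coe_toReal_of_abs_lt_top hs,
    ← EReal.coe_sub, EReal.abs_def]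

theorem upperGradientIneq_of_finite {u : X → EReal} {g : X → ℝ≥0∞} {γ : ArcPath X}
    (h0 : (u (γ.toFun 0)).abs < ⊤) (h1 : (u (γ.toFun γ.len)).abs < ⊤)
    (h : ENNReal.ofReal |(u (γ.toFun 0)).toReal - (u (γ.toFun γ.len)).toReal| ≤ γ.lineIntegral g) :
    UpperGradientIneq u g γ :=
  ⟨fun _ => (EReal.abs_sub_eq_ofReal h0 h1).trans_le h, fun hn => absurd ⟨h0, h1⟩ hn⟩

variable [MeasurableSpace X]

theorem pathModulus_mono {q : ℝ} {ν ν' : Measure X} {Γ Γ' : Set (ArcPath X)} (hν : ν ≤ ν')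
    (hΓ : Γ ⊆ Γ') : pathModulus q ν Γ ≤ pathModulus q ν' Γ' := by
  refine le_iInf fun ρ => le_iInf fun hρ => le_iInf fun h => ?_
  refine le_trans ?_ (lintegral_mono' hν le_rfl)
  exact iInf_le_of_le ρ <| iInf_le_of_le hρ <| iInf_le_of_le (fun γ hγ => h γ (hΓ hγ)) le_rfl

theorem pathModulus_null_mono {q : ℝ} {ν ν' : Measure X} {Γ Γ' : Set (ArcPath X)} (hν : ν ≤ ν')
    (hΓ : Γ ⊆ Γ') (h : pathModulus q ν' Γ' = 0) : pathModulus q ν Γ = 0 :=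
  le_antisymm ((pathModulus_mono hν hΓ).trans h.le) zero_le

theorem pathModulus_eq_zero_iff {q : ℝ} {ν : Measure X} {Γ : Set (ArcPath X)} :
    pathModulus q ν Γ = 0 ↔ ∀ ε : ℝ≥0∞, ε ≠ 0 → ∃ ρ : X → ℝ≥0∞, Measurable ρ ∧
      (∀ γ ∈ Γ, 1 ≤ γ.lineIntegral ρ) ∧ ∫⁻ x, ρ x ^ q ∂ν < ε := by
  constructor
  · intro h ε hε
    have : pathModulus q ν Γ < ε := h ▸ pos_iff_ne_zero.2 hε
    simp only [pathModulus, iInf_lt_iff] at this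
    obtain ⟨ρ, hρ, h1, h2⟩ := this
    exact ⟨ρ, hρ, h1, h2⟩
  · intro h
    by_contra hne
    obtain ⟨ρ, hρ, h1, h2⟩ := h _ hne
    exact absurd h2 (not_lt.2 (iInf_le_of_le ρ <| iInf_le_of_le hρ <| iInf_le_of_le h1 le_rfl))

/-- The `ℓ^q` combination `(∑ ρₙ^q)^(1/q)` dominates every `ρₙ`, and its `q`-energy is the sum of
theirs, which can be made arbitrarily small. -/
theorem pathModulus_iUnion_eq_zero {q : ℝ} (hq : 0 < q) {ν : Measure X}
    {Γ : ℕ → Set (ArcPath X)} (h : ∀ n, pathModulus q ν (Γ n) = 0) :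
    pathModulus q ν (⋃ n, Γ n) = 0 := by
  rw [pathModulus_eq_zero_iff]
  intro ε hε
  obtain ⟨δ, hδ, hsum⟩ := ENNReal.exists_pos_sum_of_countable hε ℕ
  choose ρ hρ h1 h2 using fun n => pathModulus_eq_zero_iff.1 (h n) (δ n)
    (by exact_mod_cast (hδ n).ne')
  have hpow : ∀ x, ((∑' n, ρ n x ^ q) ^ q⁻¹) ^ q = ∑' n, ρ n x ^ q := fun x => by
    rw [← ENNReal.rpow_mul, inv_mul_cancel₀ hq.ne', ENNReal.rpow_one]
  refine ⟨fun x => (∑' n, ρ n x ^ q) ^ q⁻¹,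
    (Measurable.tsum fun n => (hρ n).pow_const q).pow_const _, ?_, ?_⟩
  · intro γ hγ
    obtain ⟨n, hn⟩ := mem_iUnion.1 hγ
    refine (h1 n γ hn).trans (lintegral_mono fun t => ?_)
    calc ρ n (γ.toFun t) = (ρ n (γ.toFun t) ^ q) ^ q⁻¹ := by
          rw [← ENNReal.rpow_mul, mul_inv_cancel₀ hq.ne', ENNReal.rpow_one]
      _ ≤ _ := ENNReal.rpow_le_rpow (ENNReal.le_tsum n) (inv_nonneg.2 hq.le)
  · simp only [hpow]
    rw [lintegral_tsum fun n => ((hρ n).pow_const q).aemeasurable]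
    exact (ENNReal.tsum_le_tsum fun n => (h2 n).le).trans_lt hsum

theorem pathModulus_union_eq_zero {q : ℝ} (hq : 0 < q) {ν : Measure X}
    {Γ Γ' : Set (ArcPath X)} (h : pathModulus q ν Γ = 0) (h' : pathModulus q ν Γ' = 0) :
    pathModulus q ν (Γ ∪ Γ') = 0 := by
  have := pathModulus_iUnion_eq_zero hq (Γ := fun n => if n = 0 then Γ else Γ')
    (ν := ν) (fun n => by split_ifs <;> assumption)
  refine pathModulus_null_mono le_rfl ?_ this
  rintro γ (hγ | hγ)
  · exact mem_iUnion.2 ⟨0, by simpa using hγ⟩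
  · exact mem_iUnion.2 ⟨1, by simpa using hγ⟩

/-- The family of all paths on which a fixed `L^q` function has infinite integral is negligible. -/
theorem pathModulus_lineIntegral_eq_top {q : ℝ} (hq : 0 < q) {ν : Measure X} {g : X → ℝ≥0∞}
    (hg : Measurable g) (hfin : ∫⁻ x, g x ^ q ∂ν ≠ ⊤) :
    pathModulus q ν {γ | γ.lineIntegral g = ⊤} = 0 := by
  rw [pathModulus_eq_zero_iff]
  intro ε hε
  obtain ⟨δ, hδ0, hδ⟩ : ∃ δ : ℝ≥0∞, δ ≠ 0 ∧ δ * ∫⁻ x, g x ^ q ∂ν < ε := by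
    have := ENNReal.exists_nnreal_pos_mul_lt hfin hε
    obtain ⟨n, hn, h⟩ := this
    exact ⟨n, by exact_mod_cast hn.ne', h⟩
  -- A small multiple of `g` still has infinite integral along these paths, while its energy is
  -- scaled by `δ`.
  refine ⟨fun x => δ ^ q⁻¹ * g x, hg.const_mul _, ?_, ?_⟩
  · intro γ hγ
    have hle : ∀ r : ℝ≥0∞, r * γ.lineIntegral g ≤ γ.lineIntegral (fun x => r * g x) :=
      fun r => lintegral_const_mul_le _ _
    refine le_trans ?_ (hle _)
    rw [show γ.lineIntegral g = ⊤ from hγ, ENNReal.mul_top]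
    · exact le_top
    · exact fun h => hδ0 ((ENNReal.rpow_eq_zero_iff_of_pos (inv_pos.2 hq)).1 h)
  · have : ∀ x, (δ ^ q⁻¹ * g x) ^ q = δ * g x ^ q := fun x => by
      rw [ENNReal.mul_rpow_of_nonneg _ _ hq.le, ← ENNReal.rpow_mul, inv_mul_cancel₀ hq.ne',
        ENNReal.rpow_one]
    simp only [this]
    rwa [lintegral_const_mul _ (hg.pow_const q)]

/-- Paths having a subpath in a negligible family of paths in `A` form a negligible family. -/
theorem pathModulus_superpath_eq_zero {q : ℝ} (hq : 0 < q) {μ : Measure X} {A : Set X}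
    (hA : MeasurableSet A) {Γ : Set (ArcPath X)} (hΓ : ∀ γ ∈ Γ, γ.LiesIn A)
    (h : pathModulus q (μ.restrict A) Γ = 0) :
    pathModulus q μ {γ | ∃ x y, ∃ (hx : 0 ≤ x) (hxy : x < y) (hy : y ≤ γ.len),
      γ.sub x y hx hxy hy ∈ Γ} = 0 := by
  rw [pathModulus_eq_zero_iff] at h ⊢
  intro ε hε
  obtain ⟨ρ, hρ, h1, h2⟩ := h ε hε
  -- Cutting `ρ` off outside `A` does not change its integral over a subpath in `A`, and its energy
  -- then sees only `μ.restrict A`.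
  refine ⟨A.indicator ρ, hρ.indicator hA, ?_, ?_⟩
  · rintro γ ⟨x, y, hx, hxy, hy, hmem⟩
    have hin := hΓ _ hmem
    calc 1 ≤ (γ.sub x y hx hxy hy).lineIntegral ρ := h1 _ hmem
      _ = (γ.sub x y hx hxy hy).lineIntegral (A.indicator ρ) :=
        setLIntegral_congr_fun measurableSet_Icc fun t ht =>
          (indicator_of_mem (hin ht) ρ).symm
      _ = ∫⁻ t in Icc x y, A.indicator ρ (γ.toFun t) := γ.lineIntegral_sub _ hx hxy hy
      _ ≤ _ := lintegral_mono_set (Icc_subset_Icc hx hy)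
  · have : ∀ x, A.indicator ρ x ^ q = A.indicator (fun x => ρ x ^ q) x := fun x => by
      by_cases hx : x ∈ A <;> simp [hx, hq]
    simp only [this]
    rwa [lintegral_indicator hA]

theorem ArcPath.aemeasurable_comp [BorelSpace X] (γ : ArcPath X) {g : X → ℝ≥0∞}
    (hg : Measurable g) :
    AEMeasurable (fun t => g (γ.toFun t)) (volume.restrict (Icc 0 γ.len)) :=
  hg.comp_aemeasurable (γ.continuousOn.aemeasurable measurableSet_Icc)

/-- Countably many balls on which `g` is `q`-integrable cover `A`. A path is compact, so finitely
many of them cover it, and an infinite integral must be infinite over one ball. -/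
theorem pathModulus_lineIntegral_eq_top_of_locallyLq [BorelSpace X] [SecondCountableTopology X]
    {q : ℝ} (hq : 0 < q) {μ : Measure X} {A : Set X} {g : X → ℝ≥0∞}
    (hg : Measurable g) (hloc : LocallyLq q μ A g) :
    pathModulus q (μ.restrict A) {γ | γ.LiesIn A ∧ γ.lineIntegral g = ⊤} = 0 := by
  choose! r hr0 hr using hloc
  obtain ⟨t, htA, htc, hcov⟩ := TopologicalSpace.countable_cover_nhdsWithin
    (f := fun x => Metric.ball x (r x)) (s := A)
    (fun x hx => mem_nhdsWithin_of_mem_nhds (Metric.ball_mem_nhds x (hr0 x hx)))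
  rcases t.eq_empty_or_nonempty with rfl | hne
  · have : {γ : ArcPath X | γ.LiesIn A ∧ γ.lineIntegral g = ⊤} ⊆ {γ | γ.lineIntegral 0 = ⊤} := by
      rintro γ ⟨h1, -⟩
      have := hcov (h1 (left_mem_Icc.2 γ.len_pos.le))
      simp at this
    refine pathModulus_null_mono le_rfl this (pathModulus_lineIntegral_eq_top hq measurable_zero ?_)
    simp [hq]
  obtain ⟨e, he⟩ := htc.exists_eq_range hne
  have heA : ∀ n, e n ∈ A := fun n => htA (he ▸ mem_range_self n)
  let B : ℕ → Set X := fun n => Metric.ball (e n) (r (e n))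
  have hB : ∀ n, MeasurableSet (B n) := fun n => Metric.isOpen_ball.measurableSet
  refine pathModulus_null_mono le_rfl (Γ' := ⋃ n, {γ | γ.lineIntegral ((B n).indicator g) = ⊤})
    ?_ (pathModulus_iUnion_eq_zero hq fun n => pathModulus_lineIntegral_eq_top hq
      (hg.indicator (hB n)) ?_)
  · rintro γ ⟨hin, htop⟩
    by_contra hcon
    simp only [mem_iUnion, mem_ofPred_eq, not_exists] at hcon
    have hcomp : IsCompact (γ.toFun '' Icc 0 γ.len) := isCompact_Icc.image_of_continuousOn γ.continuousOn
    obtain ⟨T, hT⟩ := hcomp.elim_finite_subcover B (fun n => Metric.isOpen_ball) (by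
      rintro _ ⟨s, hs, rfl⟩
      obtain ⟨x, hx, hx'⟩ := mem_iUnion₂.1 (hcov (hin hs))
      rw [he] at hx
      obtain ⟨n, rfl⟩ := hx
      exact mem_iUnion.2 ⟨n, hx'⟩)
    have : γ.lineIntegral g ≤ ∑ n ∈ T, γ.lineIntegral ((B n).indicator g) := by
      simp only [ArcPath.lineIntegral]
      rw [← lintegral_finsetSum' _ fun n _ => γ.aemeasurable_comp (hg.indicator (hB n))]
      refine setLIntegral_mono' measurableSet_Icc fun s hs => ?_
      obtain ⟨n, hn, hs'⟩ := mem_iUnion₂.1 (hT (mem_image_of_mem _ hs))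
      calc g (γ.toFun s) = (B n).indicator g (γ.toFun s) := (indicator_of_mem hs' g).symm
        _ ≤ _ := Finset.single_le_sum (f := fun n => (B n).indicator g (γ.toFun s))
          (fun _ _ => zero_le) hn
    rw [htop, top_le_iff, ENNReal.sum_eq_top] at this
    obtain ⟨n, _, hn⟩ := this
    exact hcon n hn
  · have : ∀ x, (B n).indicator g x ^ q = (B n).indicator (fun x => g x ^ q) x := fun x => by
      by_cases hx : x ∈ B n <;> simp [hx, hq]
    simp only [this]
    rw [lintegral_indicator (hB n), Measure.restrict_restrict (hB n)]
    exact (hr _ (heA n)).ne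

/-- Every subpath of `γ` in `A` satisfies the upper gradient inequality with a finite right-hand
side; in particular `u` is finite along such subpaths. -/
def GoodPath (A : Set X) (u : X → EReal) (g : X → ℝ≥0∞) (γ : ArcPath X) : Prop :=
  ∀ x y, 0 ≤ x → x < y → y ≤ γ.len → MapsTo γ.toFun (Icc x y) A →
    (u (γ.toFun x)).abs < ⊤ ∧ (u (γ.toFun y)).abs < ⊤ ∧ ∫⁻ t in Icc x y, g (γ.toFun t) ≠ ⊤ ∧
    ENNReal.ofReal |(u (γ.toFun x)).toReal - (u (γ.toFun y)).toReal|
      ≤ ∫⁻ t in Icc x y, g (γ.toFun t)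

/-- A path that is not good has a subpath in `A` which violates the upper gradient inequality or
carries an infinite integral of `g`. Both kinds of subpath form null families, hence so do their
superpaths. -/
theorem IsWeakUpperGradient.pathModulus_not_goodPath [BorelSpace X] [SecondCountableTopology X]
    {q : ℝ} (hq : 0 < q) {μ : Measure X} {A : Set X} (hA : IsOpen A) {u : X → EReal}
    {g : X → ℝ≥0∞} (hg : IsWeakUpperGradient q μ A u g) (hloc : LocallyLq q μ A g) :
    pathModulus q μ {γ | ¬ GoodPath A u g γ} = 0 := by
  have h1 := pathModulus_union_eq_zero hq hg.2
    (pathModulus_lineIntegral_eq_top_of_locallyLq hq hg.1 hloc)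
  refine pathModulus_null_mono le_rfl ?_ (pathModulus_superpath_eq_zero hq hA.measurableSet ?_ h1)
  · intro γ hγ
    simp only [mem_ofPred_eq, GoodPath] at hγ
    push Not at hγ
    obtain ⟨x, y, hx, hxy, hy, hmaps, hbad⟩ := hγ
    refine ⟨x, y, hx, hxy, hy, ?_⟩
    have hin : (γ.sub x y hx hxy hy).LiesIn A := fun t ht =>
      hmaps ⟨by linarith [ht.1], by have := ht.2; simp only [ArcPath.sub] at this; linarith⟩
    by_cases htop : (γ.sub x y hx hxy hy).lineIntegral g = ⊤
    · exact Or.inr ⟨hin, htop⟩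
    refine Or.inl ⟨hin, fun hug => ?_⟩
    have hfin : ((u (γ.toFun x)).abs < ⊤ ∧ (u (γ.toFun y)).abs < ⊤) := by
      by_contra hcon
      refine htop (hug.2 ?_)
      simpa [ArcPath.sub] using hcon
    have hle := hug.1 (by simpa [ArcPath.sub] using hfin)
    rw [γ.lineIntegral_sub] at htop hle
    simp only [ArcPath.sub, zero_add, sub_add_cancel] at hle
    rw [EReal.abs_sub_eq_ofReal hfin.1 hfin.2] at hle
    exact absurd hle (not_le.2 (hbad hfin.1 hfin.2 htop))
  · rintro γ (hγ | hγ) <;> exact hγ.1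

end Modulus

/-! ### Existence of minimal weak upper gradients. -/

section MinimalWeakUpperGradient

variable {X : Type*} [MetricSpace X]

theorem ArcPath.absolutelyContinuous_and_abs_deriv_le [MeasurableSpace X] [BorelSpace X]
    {A : Set X} {u : X → EReal}
    {g : X → ℝ≥0∞} (hg : Measurable g) {γ : ArcPath X} (hin : γ.LiesIn A) (h : GoodPath A u g γ) :
    AbsolutelyContinuousOnInterval (fun t => (u (γ.toFun t)).toReal) 0 γ.len ∧
      ∀ᵐ t, t ∈ Ioo 0 γ.len →
        ENNReal.ofReal |deriv (fun t => (u (γ.toFun t)).toReal) t| ≤ g (γ.toFun t) := by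
  refine absolutelyContinuousOnInterval_and_abs_deriv_le γ.len_pos.le (γ.aemeasurable_comp hg)
    (h 0 γ.len le_rfl γ.len_pos le_rfl hin).2.2.1 fun x y hx hxy hy => ?_
  rcases hxy.eq_or_lt with rfl | hlt
  · simp
  · exact (h x y hx hlt hy (hin.mono_left (Icc_subset_Icc hx hy))).2.2.2

variable [MeasurableSpace X]

theorem LocallyLq.mono {q : ℝ} (hq : 0 ≤ q) {μ : Measure X} {A : Set X} {f g : X → ℝ≥0∞}
    (hg : LocallyLq q μ A g) (h : ∀ x, f x ≤ g x) : LocallyLq q μ A f := fun x hx => by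
  obtain ⟨r, hr, hfin⟩ := hg x hx
  exact ⟨r, hr, (lintegral_mono fun z => ENNReal.rpow_le_rpow (h z) hq).trans_lt hfin⟩

theorem LocallyLq.of_lintegral_ne_top {q : ℝ} {μ : Measure X} {A : Set X} {f : X → ℝ≥0∞}
    (h : ∫⁻ x in A, f x ^ q ∂μ ≠ ⊤) : LocallyLq q μ A f := fun _ _ =>
  ⟨1, one_pos, (lintegral_mono_set inter_subset_right).trans_lt h.lt_top⟩

variable [BorelSpace X] [SecondCountableTopology X]

/-- On paths good for both gradients, `g₁` and `g₂` each bound the derivative of `u` almost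
everywhere, so their minimum does too. -/
theorem IsWeakUpperGradient.inf {q : ℝ} (hq : 0 < q) {μ : Measure X} {A : Set X} (hA : IsOpen A)
    {u : X → EReal} {g₁ g₂ : X → ℝ≥0∞} (h₁ : IsWeakUpperGradient q μ A u g₁)
    (h₂ : IsWeakUpperGradient q μ A u g₂) (hl₁ : LocallyLq q μ A g₁) (hl₂ : LocallyLq q μ A g₂) :
    IsWeakUpperGradient q μ A u (fun x => min (g₁ x) (g₂ x)) := by
  refine ⟨h₁.1.min h₂.1, pathModulus_null_mono Measure.restrict_le_self ?_
    (pathModulus_union_eq_zero hq (h₁.pathModulus_not_goodPath hq hA hl₁)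
      (h₂.pathModulus_not_goodPath hq hA hl₂))⟩
  rintro γ ⟨hin, hbad⟩
  by_contra hcon
  simp only [mem_union, mem_ofPred_eq, not_or, not_not] at hcon
  obtain ⟨hγ₁, hγ₂⟩ := hcon
  have hends := hγ₁ 0 γ.len le_rfl γ.len_pos le_rfl hin
  refine hbad (upperGradientIneq_of_finite hends.1 hends.2.1 ?_)
  obtain ⟨hAC, hd₁⟩ := ArcPath.absolutelyContinuous_and_abs_deriv_le h₁.1 hin hγ₁
  obtain ⟨-, hd₂⟩ := ArcPath.absolutelyContinuous_and_abs_deriv_le h₂.1 hin hγ₂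
  refine hAC.ofReal_abs_sub_le_lintegral γ.len_pos.le ?_
  filter_upwards [hd₁, hd₂] with t ht₁ ht₂ ht
  exact le_min (ht₁ ht) (ht₂ ht)

/-- Monotone convergence for decreasing sequences applies on each path along which `g 0` has finite
integral. -/
theorem IsWeakUpperGradient.iInf {q : ℝ} (hq : 0 < q) {μ : Measure X} {A : Set X}
    {u : X → EReal} {g : ℕ → X → ℝ≥0∞} (h : ∀ n, IsWeakUpperGradient q μ A u (g n))
    (hanti : Antitone g) (hl : LocallyLq q μ A (g 0)) :
    IsWeakUpperGradient q μ A u (fun x => ⨅ n, g n x) := by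
  refine ⟨Measurable.iInf fun n => (h n).1, pathModulus_null_mono le_rfl ?_
    (pathModulus_union_eq_zero hq (pathModulus_iUnion_eq_zero hq fun n => (h n).2)
      (pathModulus_lineIntegral_eq_top_of_locallyLq hq (h 0).1 hl))⟩
  rintro γ ⟨hin, hbad⟩
  by_contra hcon
  simp only [mem_union, mem_iUnion, mem_ofPred_eq, not_or, not_exists, not_and, not_not] at hcon
  obtain ⟨hγ, htop⟩ := hcon
  specialize htop hin
  have hlim : γ.lineIntegral (fun x => ⨅ n, g n x) = ⨅ n, γ.lineIntegral (g n) :=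
    lintegral_iInf' (fun n => γ.aemeasurable_comp (h n).1)
      (Eventually.of_forall fun t m n hmn => hanti hmn _) htop
  refine hbad ⟨fun hfin => ?_, fun hfin => absurd ((hγ 0 hin).2 hfin) htop⟩
  rw [hlim]
  exact le_iInf fun n => (hγ n hin).1 hfin

/-- Running minima of a minimizing sequence for the `q`-energy decrease to a minimizer. -/
theorem exists_isMinimalWeakUpperGradient {q : ℝ} (hq : 0 < q) {μ : Measure X} {A : Set X}
    (hA : IsOpen A) {u : X → EReal} {g₀ : X → ℝ≥0∞} (h₀ : IsWeakUpperGradient q μ A u g₀)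
    (hfin : ∫⁻ x in A, g₀ x ^ q ∂μ ≠ ⊤) :
    ∃ g, IsMinimalWeakUpperGradient q μ A u g := by
  let S : Set ℝ≥0∞ := {m | ∃ g : X → ℝ≥0∞, IsWeakUpperGradient q μ A u g ∧ LocallyLq q μ A g ∧
    ∫⁻ x in A, g x ^ q ∂μ = m}
  have hl₀ : LocallyLq q μ A g₀ := .of_lintegral_ne_top hfin
  have hS : S.Nonempty := ⟨_, g₀, h₀, hl₀, rfl⟩
  obtain ⟨m, -, hm, hmS⟩ := exists_seq_tendsto_sInf hS (OrderBot.bddBelow S)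
  choose g hg hgl hgm using hmS
  let G : ℕ → X → ℝ≥0∞ := fun n => Nat.rec g₀ (fun k f x => min (f x) (g k x)) n
  have hGs : ∀ n x, G (n + 1) x = min (G n x) (g n x) := fun _ _ => rfl
  have hanti : Antitone G := antitone_nat_of_succ_le fun n x => min_le_left _ _
  have hGl : ∀ n, LocallyLq q μ A (G n) := fun n =>
    hl₀.mono hq.le fun x => hanti (Nat.zero_le n) x
  have hG : ∀ n, IsWeakUpperGradient q μ A u (G n) := fun n => by
    induction n with
    | zero => exact h₀
    | succ n ih => exact ih.inf hq hA (hg n) (hGl n) (hgl n)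
  have hGi := IsWeakUpperGradient.iInf hq hG hanti hl₀
  have hle₀ : ∀ x, ⨅ n, G n x ≤ g₀ x := fun x => iInf_le (fun n => G n x) 0
  have hGil : LocallyLq q μ A (fun x => ⨅ n, G n x) := hl₀.mono hq.le hle₀
  have hmin : ∫⁻ x in A, (⨅ n, G n x) ^ q ∂μ ≤ sInf S := by
    refine ge_of_tendsto' hm fun n => ?_
    rw [← hgm n]
    refine lintegral_mono fun x => ENNReal.rpow_le_rpow ?_ hq.le
    exact (iInf_le (fun n => G n x) (n + 1)).trans (min_le_right _ _)
  refine ⟨_, hGi, hGil, fun h hh hhl => ?_⟩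
  -- The minimum with a competitor `h` is again admissible, so it cannot have smaller energy; the
  -- two finite energies agree, which forces the minimizer to be at most `h` almost everywhere.
  have hmem : sInf S ≤ ∫⁻ x in A, (min (⨅ n, G n x) (h x)) ^ q ∂μ :=
    sInf_le ⟨_, hGi.inf hq hA hh hGil hhl, hGil.mono hq.le fun x => min_le_left _ _, rfl⟩
  have hfin' : ∫⁻ x in A, (⨅ n, G n x) ^ q ∂μ ≠ ⊤ := ne_top_of_le_ne_top hfin
    (lintegral_mono fun x => ENNReal.rpow_le_rpow (hle₀ x) hq.le)
  have hpt : ∀ x, (min (⨅ n, G n x) (h x)) ^ q ≤ (⨅ n, G n x) ^ q := fun x =>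
    ENNReal.rpow_le_rpow (min_le_left _ _) hq.le
  have heq := ae_eq_of_ae_le_of_lintegral_le (μ := μ.restrict A) (Eventually.of_forall hpt)
    (ne_top_of_le_ne_top hfin' (lintegral_mono hpt)) (hGi.1.pow_const q).aemeasurable
    (hmin.trans hmem)
  filter_upwards [heq] with x hx
  exact min_eq_left_iff.1 (ENNReal.rpow_left_injective hq.ne' hx)

end MinimalWeakUpperGradient

/-! ### Compactness from doubling. -/

section Doubling

variable {X : Type*} [MetricSpace X] [MeasurableSpace X]

/-- Otherwise the ball contains an infinite `ε`-separated sequence. The balls of radius `ε/2` about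
its points are disjoint, lie in a ball of finite measure, and by iterated doubling have measure
bounded below. -/
theorem DoublingMeasure.totallyBounded_ball [OpensMeasurableSpace X] {μ : Measure X}
    (hμ : DoublingMeasure μ) (x : X) {R : ℝ} (hR : 0 < R) :
    TotallyBounded (Metric.ball x R) := by
  obtain ⟨C, hC1, hC⟩ := hμ
  have hpow : ∀ (n : ℕ) (y : X) (r : ℝ), 0 < r →
      μ (Metric.ball y (2 ^ n * r)) ≤ (C : ℝ≥0∞) ^ n * μ (Metric.ball y r) := by
    intro n y r hr
    induction n with
    | zero => simp
    | succ n ih =>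
      have := (hC y (2 ^ n * r) (by positivity)).2.1
      rw [pow_succ', mul_assoc]
      refine this.trans ?_
      rw [pow_succ', mul_assoc]
      gcongr
  rw [Metric.totallyBounded_iff]
  intro ε hε
  by_contra hcon
  push Not at hcon
  have hstep : ∀ t : Finset X, ∃ y ∈ Metric.ball x R, ∀ z ∈ t, ε ≤ dist y z := by
    intro t
    obtain ⟨y, hy, hy'⟩ := not_subset.1 (hcon t t.finite_toSet)
    refine ⟨y, hy, fun z hz => ?_⟩
    simp only [mem_iUnion, not_exists, Metric.mem_ball, not_lt] at hy'
    exact hy' z hz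
  have : Std.Symm (fun a b : X => ε ≤ dist b a) := ⟨fun a b h => by rwa [dist_comm]⟩
  obtain ⟨z, hz1, hz2⟩ := exists_seq_of_forall_finset_exists' (fun y => y ∈ Metric.ball x R)
    (fun a b => ε ≤ dist b a) (fun t _ => hstep t)
  -- After `n` doublings a ball of radius `ε/2` centred in `B(x,R)` contains all of `B(x,R)`.
  obtain ⟨n, hn⟩ := pow_unbounded_of_one_lt (2 * R / (ε / 2)) one_lt_two
  have hn' : 2 * R < 2 ^ n * (ε / 2) := (div_lt_iff₀ (by positivity)).1 hn
  have hball : ∀ i, μ (Metric.ball x R) / (C : ℝ≥0∞) ^ n ≤ μ (Metric.ball (z i) (ε / 2)) := by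
    intro i
    refine ENNReal.div_le_of_le_mul' ((measure_mono ?_).trans (hpow n (z i) (ε / 2) (by positivity)))
    refine Metric.ball_subset_ball' ?_
    have := hz1 i
    rw [Metric.mem_ball, dist_comm] at this
    linarith
  have hpos : 0 < μ (Metric.ball x R) / (C : ℝ≥0∞) ^ n := by
    refine ENNReal.div_pos ?_ (by finiteness)
    have := (hC x (R / 2) (by positivity)).1
    rw [mul_div_cancel₀ R two_ne_zero] at this
    exact this.ne'
  have hfin := Measure.finite_const_le_meas_of_disjoint_iUnion μ hpos
    (As := fun i => Metric.ball (z i) (ε / 2)) (fun i => Metric.isOpen_ball.measurableSet)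
    (fun i j hij => Metric.ball_disjoint_ball (by
      rw [add_halves, dist_comm]; exact hz2 hij))
    (ne_top_of_le_ne_top (hC x (R + ε) (by positivity)).2.2.ne (measure_mono (by
      refine iUnion_subset fun i => Metric.ball_subset_ball' ?_
      have := hz1 i
      rw [Metric.mem_ball] at this
      linarith)))
  simp only [hball] at hfin
  exact infinite_univ hfin

/-- With compact closed balls, local `q`-integrability in `Ω` becomes integrability on closed balls
inside `Ω`. -/
theorem DoublingMeasure.properSpace [OpensMeasurableSpace X] [CompleteSpace X] {μ : Measure X}
    (hμ : DoublingMeasure μ) : ProperSpace X := by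
  refine ⟨fun x r => TotallyBounded.isCompact_of_isClosed ?_ Metric.isClosed_closedBall⟩
  refine (hμ.totallyBounded_ball x (R := |r| + 1) (by positivity)).subset ?_
  exact Metric.closedBall_subset_ball (by linarith [le_abs_self r])

theorem LocallyLq.lintegral_lt_top_of_isCompact {q : ℝ} {μ : Measure X} {A K : Set X}
    {f : X → ℝ≥0∞} (hf : LocallyLq q μ A f) (hA : IsOpen A) (hK : IsCompact K) (hKA : K ⊆ A) :
    ∫⁻ x in K, f x ^ q ∂μ < ⊤ := by
  refine hK.induction_on (p := fun s => ∫⁻ x in s, f x ^ q ∂μ < ⊤) (by simp)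
    (fun s t hst h => (lintegral_mono_set hst).trans_lt h)
    (fun s t hs ht => (lintegral_union_le _ _ _).trans_lt (ENNReal.add_lt_top.2 ⟨hs, ht⟩))
    fun x hx => ?_
  obtain ⟨r, hr, hfin⟩ := hf x (hKA hx)
  exact ⟨_, mem_nhdsWithin_of_mem_nhds (inter_mem (Metric.ball_mem_nhds x hr)
    (hA.mem_nhds (hKA hx))), hfin⟩

end Doubling

/-! ### The absorption lemma. -/

/-- The iteration lemma of Giaquinta type, absorbing a fraction of the function on a larger ball. -/
theorem exists_const_of_absorption {p q θ : ℝ} (hp : 0 < p) (hpq : p ≤ q) (hθ0 : 0 ≤ θ)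
    (hθ : θ < 1) :
    ∃ C : ℝ, 0 < C ∧ ∀ (Φ : ℝ → ℝ) (ρ R A B T : ℝ), ρ < R → 0 ≤ A → 0 ≤ B →
      (∀ t, ρ ≤ t → t ≤ R → 0 ≤ Φ t ∧ Φ t ≤ T) →
      (∀ t s, ρ ≤ t → t < s → s ≤ R → Φ t ≤ θ * Φ s + (A / (s - t) ^ p + B / (s - t) ^ q)) →
      Φ ρ ≤ C * (A / (R - ρ) ^ p + B / (R - ρ) ^ q) := by
  have hq : 0 < q := hp.trans_le hpq
  set κ : ℝ := (1 + θ) / 2 with hκ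
  have hκ0 : 0 < κ := by positivity
  have hκ1 : κ < 1 := by rw [hκ]; linarith
  have hθκ : θ / κ < 1 := by rw [div_lt_one hκ0, hκ]; linarith
  -- With `s = R - σ (R-t)` one has `(R-s)^q = κ (R-t)^q`. As `θ < κ < 1`, the weight `(R-t)^q`
  -- costs a factor `1/κ` and the contraction factor `θ/κ` stays below 1.
  set σ : ℝ := κ ^ q⁻¹ with hσ
  have hσ0 : 0 < σ := Real.rpow_pos_of_pos hκ0 _
  have hσ1 : σ < 1 := Real.rpow_lt_one hκ0.le hκ1 (inv_pos.2 hq)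
  have hσq : σ ^ q = κ := Real.rpow_inv_rpow hκ0.le hq.ne'
  have hD : 0 < (1 - σ) ^ q := Real.rpow_pos_of_pos (by linarith) _
  refine ⟨1 / (1 - σ) ^ q / (1 - θ / κ), div_pos (by positivity) (by linarith), ?_⟩
  intro Φ ρ R A B T hρR hA hB hΦ hstep
  have hd : 0 < R - ρ := sub_pos.2 hρR
  -- The supremum of the weighted function replaces an infinite iteration; the bound `T` makes it
  -- finite, so that it can be absorbed.
  let S : Set ℝ := (fun t => (R - t) ^ q * Φ t) '' Ico ρ R
  have hbdd : BddAbove S := by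
    refine ⟨(R - ρ) ^ q * T, ?_⟩
    rintro _ ⟨t, ⟨ht, ht'⟩, rfl⟩
    have h1 := hΦ t ht ht'.le
    have : (R - t) ^ q ≤ (R - ρ) ^ q :=
      Real.rpow_le_rpow (by linarith) (by linarith) hq.le
    exact mul_le_mul this h1.2 h1.1 (by positivity)
  have hρS : (R - ρ) ^ q * Φ ρ ∈ S := ⟨ρ, ⟨le_rfl, hρR⟩, rfl⟩
  set W : ℝ := 1 / (1 - σ) ^ q * (A * (R - ρ) ^ (q - p) + B) with hW
  have hsup : sSup S ≤ θ / κ * sSup S + W := by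
    refine csSup_le ⟨_, hρS⟩ ?_
    rintro _ ⟨t, ⟨ht, ht'⟩, rfl⟩
    have htR : 0 < R - t := sub_pos.2 ht'
    have hst : R - σ * (R - t) - t = (1 - σ) * (R - t) := by ring
    have hσt : σ * (R - t) < R - t := by nlinarith
    have h0 : 0 < σ * (R - t) := by positivity
    have h1 := hstep t (R - σ * (R - t)) ht (by linarith) (by linarith)
    have h2 : (σ * (R - t)) ^ q * Φ (R - σ * (R - t)) ≤ sSup S := by
      refine le_csSup hbdd ⟨R - σ * (R - t), ⟨by linarith, by linarith⟩, ?_⟩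
      simp
    rw [Real.mul_rpow hσ0.le htR.le, hσq] at h2
    rw [hst, Real.mul_rpow (by linarith) htR.le, Real.mul_rpow (by linarith) htR.le] at h1
    have hE : 0 < (R - t) ^ q := Real.rpow_pos_of_pos htR _
    have hE' : 0 < (R - t) ^ p := Real.rpow_pos_of_pos htR _
    have hDp : 0 < (1 - σ) ^ p := Real.rpow_pos_of_pos (by linarith) _
    have hDpq : (1 - σ) ^ q ≤ (1 - σ) ^ p :=
      Real.rpow_le_rpow_of_exponent_ge (by linarith) (by linarith) hpq
    -- The weight has the larger exponent `q`, so the term with exponent `p` keeps a nonnegative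
    -- power of `R - t`, largest at `t = ρ`.
    have hqp : (R - t) ^ q / (R - t) ^ p ≤ (R - ρ) ^ (q - p) := by
      rw [← Real.rpow_sub htR]
      exact Real.rpow_le_rpow htR.le (by linarith) (by linarith)
    calc (R - t) ^ q * Φ t
        ≤ (R - t) ^ q * (θ * Φ (R - σ * (R - t)) +
          (A / ((1 - σ) ^ p * (R - t) ^ p) + B / ((1 - σ) ^ q * (R - t) ^ q))) := by gcongr
      _ = θ / κ * (κ * (R - t) ^ q * Φ (R - σ * (R - t))) +
          (1 / (1 - σ) ^ p * (A * ((R - t) ^ q / (R - t) ^ p)) + 1 / (1 - σ) ^ q * B) := by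
        field_simp
      _ ≤ θ / κ * sSup S +
          (1 / (1 - σ) ^ q * (A * (R - ρ) ^ (q - p)) + 1 / (1 - σ) ^ q * B) := by gcongr
      _ = _ := by rw [hW]; ring
  have hfinal : sSup S ≤ W / (1 - θ / κ) := by
    rw [le_div_iff₀ (by linarith)]
    linarith
  have hle := (le_csSup hbdd hρS).trans hfinal
  have hRq : 0 < (R - ρ) ^ q := Real.rpow_pos_of_pos hd _
  rw [← le_div_iff₀' hRq] at hle
  refine hle.trans (le_of_eq ?_)
  rw [hW, Real.rpow_sub hd]
  have hRp : 0 < (R - ρ) ^ p := Real.rpow_pos_of_pos hd _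
  have : 1 - θ / κ ≠ 0 := by linarith
  field_simp

/-! ### Weak upper gradients of the test function. -/

section Truncation

variable {X : Type*} [MetricSpace X]

theorem lintegral_Icc_add_right (f : ℝ → ℝ≥0∞) (x y z : ℝ) :
    ∫⁻ t in Icc x y, f (t + z) = ∫⁻ t in Icc (x + z) (y + z), f t := by
  have h := (measurePreserving_add_right volume z).setLIntegral_comp_preimage_emb
    (MeasurableEquiv.addRight z).measurableEmbedding f (Icc (x + z) (y + z))
  have h2 : (fun t : ℝ => t + z) ⁻¹' Icc (x + z) (y + z) = Icc x y := by
    rw [preimage_add_const_Icc, add_sub_cancel_right, add_sub_cancel_right]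
  rw [← h, h2]

theorem GoodPath.sub {A : Set X} {u : X → EReal} {g : X → ℝ≥0∞} {γ : ArcPath X}
    (h : GoodPath A u g γ) {x y : ℝ} (hx : 0 ≤ x) (hxy : x < y) (hy : y ≤ γ.len) :
    GoodPath A u g (γ.sub x y hx hxy hy) := by
  intro x' y' hx' hxy' hy' hin
  have hy'' : y' ≤ y - x := hy'
  have := h (x' + x) (y' + x) (by linarith) (by linarith) (by linarith) (by
    intro t ht
    have := hin (x := t - x) ⟨by linarith [ht.1], by linarith [ht.2]⟩
    simpa [ArcPath.sub] using this)
  simp only [← lintegral_Icc_add_right] at this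
  exact this

/-- The path may leave `A`, but by openness a short initial piece stays inside, and goodness applies
to that piece. -/
theorem GoodPath.finite_left {A : Set X} (hA : IsOpen A) {u : X → EReal} {g : X → ℝ≥0∞}
    {γ : ArcPath X} (h : GoodPath A u g γ) (h0 : γ.toFun 0 ∈ A) : (u (γ.toFun 0)).abs < ⊤ := by
  have h1 : ∀ᶠ t in 𝓝[Icc 0 γ.len] 0, γ.toFun t ∈ A :=
    (γ.continuousOn 0 (left_mem_Icc.2 γ.len_pos.le)).eventually (hA.mem_nhds h0)
  obtain ⟨ε, hε, hεA⟩ := Metric.mem_nhdsWithin_iff.1 h1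
  have hmin : 0 < min γ.len (ε / 2) := lt_min γ.len_pos (by positivity)
  refine (h 0 _ le_rfl hmin (min_le_left _ _) fun t ht => hεA ⟨?_, ht.1, ?_⟩).1
  · rw [Metric.mem_ball, Real.dist_eq, sub_zero, abs_of_nonneg ht.1]
    linarith [ht.2.trans (min_le_right _ _)]
  · exact ht.2.trans (min_le_left _ _)

theorem GoodPath.finite_right {A : Set X} (hA : IsOpen A) {u : X → EReal} {g : X → ℝ≥0∞}
    {γ : ArcPath X} (h : GoodPath A u g γ) (h0 : γ.toFun γ.len ∈ A) :
    (u (γ.toFun γ.len)).abs < ⊤ := by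
  have h1 : ∀ᶠ t in 𝓝[Icc 0 γ.len] γ.len, γ.toFun t ∈ A :=
    (γ.continuousOn γ.len (right_mem_Icc.2 γ.len_pos.le)).eventually (hA.mem_nhds h0)
  obtain ⟨ε, hε, hεA⟩ := Metric.mem_nhdsWithin_iff.1 h1
  have hmin : max 0 (γ.len - ε / 2) < γ.len := max_lt γ.len_pos (by linarith)
  refine (h _ _ (le_max_left _ _) hmin le_rfl fun t ht => hεA ⟨?_, ?_, ht.2⟩).2.1
  · rw [Metric.mem_ball, Real.dist_eq, abs_sub_comm, abs_of_nonneg (by linarith [ht.2])]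
    linarith [(le_max_right _ _).trans ht.1]
  · exact (le_max_left _ _).trans ht.1

/-- The weak upper gradient of the truncation `u - η (u - k)₊`. -/
noncomputable def truncationGradient {X : Type*} (U η : X → ℝ) (g : X → ℝ≥0∞) (N : Set X) (k c : ℝ) (x : X) : ℝ≥0∞ :=
  ENNReal.ofReal (1 - if k < U x then η x else 0) * g x + ENNReal.ofReal (c * max (U x - k) 0)
    + N.indicator (fun _ => ⊤) x

theorem measurable_truncationGradient {X : Type*} [MeasurableSpace X] {U η : X → ℝ} {g : X → ℝ≥0∞} {N : Set X} {k c : ℝ}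
    (hU : Measurable U) (hη : Measurable η) (hg : Measurable g) (hN : MeasurableSet N) :
    Measurable (truncationGradient U η g N k c) := by
  have h1 : Measurable fun x => if k < U x then η x else 0 :=
    Measurable.ite (measurableSet_lt measurable_const hU) hη measurable_const
  exact (((measurable_const.sub h1).ennreal_ofReal.mul hg).add
    (((hU.sub_const k).max measurable_const).const_mul c).ennreal_ofReal).add
      (measurable_const.indicator hN)

variable [MeasurableSpace X] [BorelSpace X]

/-- `U` is a Borel stand-in for `u`, which is only almost everywhere measurable; the value `⊤` on
the exceptional set `N` makes paths that spend positive length there harmless. -/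
theorem GoodPath.truncation {A : Set X} {u : X → EReal} {g : X → ℝ≥0∞} {γ : ArcPath X}
    (h : GoodPath A u g γ) (hin : γ.LiesIn A) (hg : Measurable g) {U η : X → ℝ} (hU : Measurable U)
    {N : Set X} (hN : MeasurableSet N) (hUN : ∀ x, x ∉ N → (u x).toReal = U x) {k c : ℝ}
    (hηc : Measurable η) (hη1 : ∀ x, η x ≤ 1) (hη : ∀ x y, |η x - η y| ≤ c * dist x y)
    (hc : 0 ≤ c) :
    ENNReal.ofReal |((u (γ.toFun 0)).toReal - η (γ.toFun 0) * max ((u (γ.toFun 0)).toReal - k) 0) -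
      ((u (γ.toFun γ.len)).toReal -
        η (γ.toFun γ.len) * max ((u (γ.toFun γ.len)).toReal - k) 0)| ≤
      γ.lineIntegral (truncationGradient U η g N k c) := by
  have hmeas : Measurable (truncationGradient U η g N k c) :=
    measurable_truncationGradient hU hηc hg hN
  by_cases htop : γ.lineIntegral (truncationGradient U η g N k c) = ⊤
  · exact htop ▸ le_top
  obtain ⟨hAC, hd⟩ := ArcPath.absolutelyContinuous_and_abs_deriv_le hg hin h
  obtain ⟨hAC', hd'⟩ := ofReal_abs_deriv_truncation_le (η := fun t => η (γ.toFun t)) (k := k)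
    (c := c) γ.len_pos.le hAC hd (fun t => hη1 _) (fun x hx y hy => (hη _ _).trans
      (mul_le_mul_of_nonneg_left (γ.lipschitz hx hy) hc))
  refine hAC'.ofReal_abs_sub_le_lintegral γ.len_pos.le ?_
  -- The integral is finite, so the path avoids `N` for almost every parameter, and there `U` is the
  -- real value of `u`.
  have hfin := ae_lt_top' (γ.aemeasurable_comp hmeas) htop
  rw [ae_restrict_iff' measurableSet_Icc] at hfin
  filter_upwards [hd', hfin] with t ht1 ht2 ht
  specialize ht1 ht
  specialize ht2 (Ioo_subset_Icc_self ht)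
  have hnot : γ.toFun t ∉ N := fun hmem => by
    simp [truncationGradient, hmem] at ht2
  refine ht1.trans ?_
  simp only [truncationGradient, indicator_of_notMem hnot, add_zero, hUN _ hnot, le_refl]

variable [SecondCountableTopology X]

theorem IsWeakUpperGradient.truncation {q : ℝ} (hq : 0 < q) {μ : Measure X} {A A' : Set X}
    (hA : IsOpen A) (hA' : A' ⊆ A) {u : X → EReal} {g : X → ℝ≥0∞}
    (hg : IsWeakUpperGradient q μ A u g) (hloc : LocallyLq q μ A g)
    {U η : X → ℝ} (hU : Measurable U)
    {N : Set X} (hN : MeasurableSet N) (hUN : ∀ x, x ∉ N → (u x).toReal = U x) {k c : ℝ}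
    (hηc : Measurable η) (hη1 : ∀ x, η x ≤ 1) (hη : ∀ x y, |η x - η y| ≤ c * dist x y)
    (hc : 0 ≤ c) :
    IsWeakUpperGradient q μ A'
      (fun x => (((u x).toReal - η x * max ((u x).toReal - k) 0 : ℝ) : EReal))
      (truncationGradient U η g N k c) := by
  refine ⟨measurable_truncationGradient hU hηc hg.1 hN, pathModulus_null_mono
    Measure.restrict_le_self ?_ (hg.pathModulus_not_goodPath hq hA hloc)⟩
  rintro γ ⟨hin, hbad⟩ hgood
  refine hbad (upperGradientIneq_of_finite (EReal.abs_coe_lt_top _) (EReal.abs_coe_lt_top _) ?_)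
  simp only [EReal.toReal_coe]
  exact hgood.truncation (hin.mono_right hA') hg.1 hU hN hUN hηc hη1 hη hc

open Classical in
-- The open sets `V` and `Zᶜ` cover the space, so every path splits into finitely many pieces, each
-- in one of them. In `V` the function is `η (u-k)₊`, the difference of `u` and the truncation, so
-- the sum of their gradients serves; off `Z` it is zero.
theorem IsWeakUpperGradient.zeroExtension_truncation {q : ℝ} (hq : 0 < q) {μ : Measure X}
    {A V Z A' : Set X} (hA : IsOpen A) (hV : IsOpen V) (hZ : IsClosed Z) (hVA : V ⊆ A)
    (hZV : Z ⊆ V) (hA'Z : A' ⊆ Z) {u : X → EReal} {g : X → ℝ≥0∞}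
    (hg : IsWeakUpperGradient q μ A u g) (hloc : LocallyLq q μ A g)
    {U η : X → ℝ} (hU : Measurable U)
    {N : Set X} (hN : MeasurableSet N) (hUN : ∀ x, x ∉ N → (u x).toReal = U x) {k c : ℝ}
    (hηc : Measurable η) (hη1 : ∀ x, η x ≤ 1) (hη : ∀ x y, |η x - η y| ≤ c * dist x y)
    (hc : 0 ≤ c) (hzero : ∀ x ∈ V, x ∉ A' → η x * max ((u x).toReal - k) 0 = 0) :
    IsWeakUpperGradient q μ univ
      (fun x => if x ∈ A' then
        u x - (((u x).toReal - η x * max ((u x).toReal - k) 0 : ℝ) : EReal) else 0)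
      (V.indicator fun x => g x + truncationGradient U η g N k c x) := by
  set w : X → EReal := fun x => if x ∈ A' then
        u x - (((u x).toReal - η x * max ((u x).toReal - k) 0 : ℝ) : EReal) else 0 with hw
  set H : X → ℝ≥0∞ := V.indicator fun x => g x + truncationGradient U η g N k c x with hH
  have hA'V : A' ⊆ V := hA'Z.trans hZV
  have hmeas : Measurable (truncationGradient U η g N k c) :=
    measurable_truncationGradient hU hηc hg.1 hN
  have hwV : ∀ x ∈ V, (u x).abs < ⊤ →
      w x = ((η x * max ((u x).toReal - k) 0 : ℝ) : EReal) := by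
    intro x hx hfin
    by_cases hxA : x ∈ A'
    · simp only [hw, if_pos hxA]
      conv_lhs => rw [← EReal.coe_toReal_of_abs_lt_top hfin]
      rw [EReal.toReal_coe, ← EReal.coe_sub]
      congr 1
      ring
    · simp only [hw, if_neg hxA, hzero x hx hxA, EReal.coe_zero]
  have hwfin : ∀ x, (x ∈ A → (u x).abs < ⊤) → (w x).abs < ⊤ := by
    intro x hx
    by_cases hxA : x ∈ A'
    · rw [hwV x (hA'V hxA) (hx (hVA (hA'V hxA)))]
      exact EReal.abs_coe_lt_top _
    · simp [hw, hxA]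
  refine ⟨(hg.1.add hmeas).indicator hV.measurableSet, pathModulus_null_mono
    Measure.restrict_le_self ?_ (hg.pathModulus_not_goodPath hq hA hloc)⟩
  rintro γ ⟨-, hbad⟩ hgood
  refine hbad (upperGradientIneq_of_finite (hwfin _ fun h => hgood.finite_left hA h)
    (hwfin _ fun h => hgood.finite_right hA h) ?_)
  have hpiece : ∀ x y, 0 ≤ x → x < y → y ≤ γ.len →
      (MapsTo γ.toFun (Icc x y) V ∨ MapsTo γ.toFun (Icc x y) Zᶜ) →
      ENNReal.ofReal |(w (γ.toFun x)).toReal - (w (γ.toFun y)).toReal| ≤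
        ∫⁻ t in Icc x y, H (γ.toFun t) := by
    rintro x y hx hxy hy (hin | hin)
    · have hgd := hgood x y hx hxy hy (hin.mono_right hVA)
      have hin' : (γ.sub x y hx hxy hy).LiesIn V := by
        intro t ht
        have h2 : t ≤ y - x := ht.2
        exact hin ⟨by linarith [ht.1], by linarith⟩
      have htr := (hgood.sub hx hxy hy).truncation (hin'.mono_right hVA) hg.1 hU hN hUN
        (k := k) hηc hη1 hη hc
      rw [γ.lineIntegral_sub] at htr
      simp only [ArcPath.sub, zero_add, sub_add_cancel] at htr
      rw [hwV _ (hin (left_mem_Icc.2 hxy.le)) hgd.1, hwV _ (hin (right_mem_Icc.2 hxy.le)) hgd.2.1,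
        EReal.toReal_coe, EReal.toReal_coe]
      have hHeq : ∫⁻ t in Icc x y, H (γ.toFun t) = (∫⁻ t in Icc x y, g (γ.toFun t)) +
          ∫⁻ t in Icc x y, truncationGradient U η g N k c (γ.toFun t) := by
        rw [← lintegral_add_left' ((γ.aemeasurable_comp hg.1).mono_set (Icc_subset_Icc hx hy))]
        exact setLIntegral_congr_fun measurableSet_Icc fun t ht => by
          simp only [hH, indicator_of_mem (hin ht)]
      rw [hHeq]
      refine le_trans ?_ (add_le_add hgd.2.2.2 htr)
      rw [← ENNReal.ofReal_add (abs_nonneg _) (abs_nonneg _)]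
      refine ENNReal.ofReal_le_ofReal ((le_of_eq ?_).trans (abs_sub _ _))
      ring_nf
    · have h0 : ∀ t ∈ Icc x y, w (γ.toFun t) = 0 := fun t ht => by
        simp only [hw, if_neg fun h => hin ht (hA'Z h)]
      rw [h0 x (left_mem_Icc.2 hxy.le), h0 y (right_mem_Icc.2 hxy.le)]
      simp
  have hcont : Continuous fun t : Icc 0 γ.len => γ.toFun t :=
    continuousOn_iff_continuous_domRestrict.1 γ.continuousOn
  obtain ⟨τ, hτ0, hτm, ⟨m, hm⟩, hτ⟩ := exists_monotone_Icc_subset_open_cover_Icc γ.len_pos.le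
    (c := fun b : Bool => (fun t : Icc 0 γ.len => γ.toFun t) ⁻¹' (if b then V else Zᶜ))
    (fun b => by
      cases b
      · exact hZ.isOpen_compl.preimage hcont
      · exact hV.preimage hcont)
    (fun t _ => by
      by_cases ht : γ.toFun t ∈ V
      · exact mem_iUnion.2 ⟨true, ht⟩
      · exact mem_iUnion.2 ⟨false, fun h => ht (hZV h)⟩)
  have hchain : ∀ n, ENNReal.ofReal |(w (γ.toFun 0)).toReal - (w (γ.toFun (τ n))).toReal| ≤
      ∫⁻ t in Icc 0 (τ n : ℝ), H (γ.toFun t) := by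
    intro n
    induction n with
    | zero => simp [hτ0]
    | succ n ih =>
      have hle : (τ n : ℝ) ≤ τ (n + 1) := hτm (Nat.le_succ n)
      rcases hle.eq_or_lt with heq | hlt
      · rwa [← heq]
      have hp := hpiece _ _ (τ n).2.1 hlt (τ (n + 1)).2.2 (by
        obtain ⟨b, hb⟩ := hτ n
        have hb' : MapsTo γ.toFun (Icc (τ n : ℝ) (τ (n + 1))) (if b then V else Zᶜ) := by
          intro t ht
          exact hb (a := ⟨t, (τ n).2.1.trans ht.1, ht.2.trans (τ (n + 1)).2.2⟩) ⟨ht.1, ht.2⟩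
        cases b
        · exact Or.inr hb'
        · exact Or.inl hb')
      have hsplit : ∫⁻ t in Icc 0 (τ (n + 1) : ℝ), H (γ.toFun t) =
          (∫⁻ t in Icc 0 (τ n : ℝ), H (γ.toFun t)) +
            ∫⁻ t in Icc (τ n : ℝ) (τ (n + 1)), H (γ.toFun t) := by
        rw [setLIntegral_congr (Ioc_ae_eq_Icc (a := (τ n : ℝ))).symm,
          ← lintegral_union measurableSet_Ioc, Icc_union_Ioc_eq_Icc (τ n).2.1 hle]
        exact disjoint_left.2 fun t ht ht' => not_lt.2 ht.2 ht'.1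
      rw [hsplit]
      refine le_trans ?_ (add_le_add ih hp)
      rw [← ENNReal.ofReal_add (abs_nonneg _) (abs_nonneg _)]
      exact ENNReal.ofReal_le_ofReal (abs_sub_le _ _ _)
  have := hchain m
  rwa [hm m le_rfl] at this

end Truncation

/-! ### Quasiminimality tested with the truncation. -/

section EnergyComparison

theorem measurable_ereal_abs : Measurable EReal.abs :=
  EReal.measurable_of_measurable_real (by
    simp only [EReal.abs_def]
    exact (measurable_id.max measurable_neg).ennreal_ofReal)

theorem EReal.ofReal_abs_toReal_le (r : EReal) : ENNReal.ofReal |r.toReal| ≤ r.abs := by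
  induction r with
  | bot => simp
  | top => simp
  | coe r => simp [EReal.abs_def]

/-- The integrand `a s ^ p + b s ^ q` of the energy. -/
noncomputable def pqDensity (p q a b : ℝ) (s : ℝ≥0∞) : ℝ≥0∞ :=
  ENNReal.ofReal a * s ^ p + ENNReal.ofReal b * s ^ q

theorem pqDensity_mono {p q : ℝ} (hp : 0 ≤ p) (hq : 0 ≤ q) (a b : ℝ) {s t : ℝ≥0∞} (h : s ≤ t) :
    pqDensity p q a b s ≤ pqDensity p q a b t := by
  unfold pqDensity
  gcongr

theorem pqDensity_add_le {p q : ℝ} (hp : 1 ≤ p) (hpq : p ≤ q) (a b : ℝ) (s t : ℝ≥0∞) :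
    pqDensity p q a b (s + t) ≤ 2 ^ q * (pqDensity p q a b s + pqDensity p q a b t) := by
  have h : ∀ r : ℝ, 1 ≤ r → r ≤ q → (s + t) ^ r ≤ 2 ^ q * (s ^ r + t ^ r) := by
    intro r hr hrq
    refine (ENNReal.rpow_add_le_mul_rpow_add_rpow s t hr).trans ?_
    gcongr
    · norm_num
    · linarith
  calc pqDensity p q a b (s + t)
      ≤ ENNReal.ofReal a * (2 ^ q * (s ^ p + t ^ p)) +
        ENNReal.ofReal b * (2 ^ q * (s ^ q + t ^ q)) := by
        unfold pqDensity
        gcongr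
        · exact h p hp hpq
        · exact h q (hp.trans hpq) le_rfl
    _ = _ := by unfold pqDensity; ring

theorem pqDensity_le {p q a b β : ℝ} (hp : 0 ≤ p) (hpq : p ≤ q) (ha : a ≤ β) (hb : b ≤ β)
    (s : ℝ≥0∞) : pqDensity p q a b s ≤ ENNReal.ofReal β * (1 + 2 * s ^ q) := by
  have h : s ^ p ≤ 1 + s ^ q := by
    rcases le_total s 1 with hs | hs
    · exact (ENNReal.rpow_le_one hs hp).trans le_self_add
    · exact (ENNReal.rpow_le_rpow_of_exponent_le hs hpq).trans le_add_self
  calc pqDensity p q a b s ≤ ENNReal.ofReal β * (1 + s ^ q) + ENNReal.ofReal β * s ^ q := by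
        unfold pqDensity
        gcongr
    _ = _ := by ring

variable {X : Type*} [MeasurableSpace X]

theorem AEMeasurable.pqDensity {p q : ℝ} {μ : Measure X} {a b : X → ℝ} {g : X → ℝ≥0∞}
    (ha : AEMeasurable a μ) (hb : AEMeasurable b μ) (hg : AEMeasurable g μ) :
    AEMeasurable (fun x => pqDensity p q (a x) (b x) (g x)) μ :=
  (ha.ennreal_ofReal.mul (hg.pow_const p)).add (hb.ennreal_ofReal.mul (hg.pow_const q))

theorem pqEnergy_eq_lintegral_pqDensity {p q : ℝ} {μ : Measure X} {a b : X → ℝ} {g : X → ℝ≥0∞}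
    (ha : AEMeasurable a μ) (hg : Measurable g) (A : Set X) :
    pqEnergy p q μ a b A g = ∫⁻ x in A, pqDensity p q (a x) (b x) (g x) ∂μ :=
  (lintegral_add_left' (ha.ennreal_ofReal.mul (hg.pow_const p).aemeasurable).restrict _).symm

theorem lintegral_pqDensity_lt_top {p q β : ℝ} {μ : Measure X} {a b : X → ℝ} {g : X → ℝ≥0∞}
    {A : Set X} (hp : 0 ≤ p) (hpq : p ≤ q) (ha : ∀ x, a x ≤ β) (hb : ∀ x, b x ≤ β)
    (hA : μ A < ⊤) (hg : ∫⁻ x in A, g x ^ q ∂μ < ⊤) :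
    ∫⁻ x in A, pqDensity p q (a x) (b x) (g x) ∂μ < ⊤ := by
  refine (lintegral_mono fun x => pqDensity_le hp hpq (ha x) (hb x) (g x)).trans_lt ?_
  rw [lintegral_const_mul' _ _ ENNReal.ofReal_ne_top, lintegral_add_left measurable_const,
    lintegral_const_mul' _ _ (by norm_num)]
  simp only [lintegral_one, Measure.restrict_apply_univ]
  finiteness

theorem ae_abs_lt_top {q : ℝ} (hq : 0 < q) {μ : Measure X} {u : X → EReal}
    (hu : AEMeasurable u μ) (hfin : ∫⁻ x, (u x).abs ^ q ∂μ ≠ ⊤) : ∀ᵐ x ∂μ, (u x).abs < ⊤ := by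
  filter_upwards [ae_lt_top' ((measurable_ereal_abs.comp_aemeasurable hu).pow_const q) hfin]
    with x hx
  exact (ENNReal.rpow_lt_top_iff_of_pos hq).1 hx

variable [MetricSpace X] [BorelSpace X]

open Classical in
-- Since `η (u-k)₊` vanishes off the possibly non-open set `E = B(y,s) ∩ {u > k}`, the same test
-- function is admissible on every open set between `E` and `B(y,s)`. Letting these sets shrink to
-- `E` is possible because the energy of the truncation is finite.
theorem IsQuasiminimizer.lintegral_pqDensity_le_truncation [ProperSpace X] {p q K β : ℝ}
    (hp : 1 < p) (hpq : p < q) {μ : Measure X}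
    (hμ : ∀ (x : X) (r : ℝ), 0 < r → μ (Metric.ball x r) < ⊤)
    {Ω : Set X} (hΩ : IsOpen Ω) {a b : X → ℝ} (ha : AEMeasurable a μ)
    (haβ : ∀ x, a x ≤ β) (hbβ : ∀ x, b x ≤ β) {u : X → EReal}
    (hu : IsQuasiminimizer p q K μ a b Ω u) {gu : X → ℝ≥0∞}
    (hgu : IsMinimalWeakUpperGradient q μ Ω u gu) {y : X} {s s' : ℝ} (hs : 0 < s) (hss' : s < s')
    (hball : Metric.closedBall y s' ⊆ Ω) {U η : X → ℝ} (hU : Measurable U)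
    {N : Set X} (hN : MeasurableSet N) (hN0 : μ (N ∩ Ω) = 0)
    (hUN : ∀ x, x ∉ N → (u x).toReal = U x) {k c : ℝ}
    (hηc : Measurable η) (hη0 : ∀ x, 0 ≤ η x) (hη1 : ∀ x, η x ≤ 1)
    (hη : ∀ x y, |η x - η y| ≤ c * dist x y) (hc : 0 ≤ c)
    (hsupp : ∀ x, x ∉ Metric.ball y s → η x = 0) :
    ∫⁻ x in Metric.ball y s ∩ {x | k < (u x).toReal}, pqDensity p q (a x) (b x) (gu x) ∂μ ≤
      ENNReal.ofReal K * ∫⁻ x in Metric.ball y s ∩ {x | k < (u x).toReal},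
        pqDensity p q (a x) (b x) (truncationGradient U η gu N k c x) ∂μ := by
  have hq1 : 1 < q := hp.trans hpq
  have hq : 0 < q := by linarith
  set h : X → ℝ≥0∞ := truncationGradient U η gu N k c with hh
  set v : X → EReal := fun x => (((u x).toReal - η x * max ((u x).toReal - k) 0 : ℝ) : EReal)
    with hv
  set V := Metric.ball y s' with hVdef
  have hVo : IsOpen V := Metric.isOpen_ball
  have hVK : V ⊆ Metric.closedBall y s' := Metric.ball_subset_closedBall
  have hVΩ : V ⊆ Ω := hVK.trans hball
  have hμV : μ V < ⊤ := hμ y s' (hs.trans hss')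
  have hK : IsCompact (Metric.closedBall y s') := isCompact_closedBall y s'
  have hhm : Measurable h := measurable_truncationGradient hU hηc hgu.1.1 hN
  have huV : AEMeasurable u (μ.restrict V) :=
    hu.1.1.mono_measure (Measure.restrict_mono_set μ hVΩ)
  have hguV : ∫⁻ x in V, gu x ^ q ∂μ < ⊤ := (lintegral_mono_set hVK).trans_lt
    (hgu.2.1.lintegral_lt_top_of_isCompact hΩ hK hball)
  have huqV : ∫⁻ x in V, (u x).abs ^ q ∂μ < ⊤ := (lintegral_mono_set hVK).trans_lt
    (hu.1.2.1.lintegral_lt_top_of_isCompact hΩ hK hball)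
  have hufin : ∀ᵐ x ∂μ.restrict V, (u x).abs < ⊤ := ae_abs_lt_top hq huV huqV.ne
  have hnotN : ∀ᵐ x ∂μ.restrict V, x ∉ N := by
    rw [ae_restrict_iff' hVo.measurableSet, ae_iff]
    refine measure_mono_null (fun x hx => ?_) hN0
    simp only [mem_ofPred_eq, Classical.not_imp, not_not] at hx
    exact ⟨hx.2, hVΩ hx.1⟩
  have hconst : ∫⁻ _ in V, ENNReal.ofReal |k| ^ q ∂μ < ⊤ := by
    rw [setLIntegral_const]
    finiteness
  have habsV : AEMeasurable (fun x => (u x).abs) (μ.restrict V) :=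
    measurable_ereal_abs.comp_aemeasurable huV
  have hsum : ∫⁻ x in V, ((u x).abs + ENNReal.ofReal |k|) ^ q ∂μ < ⊤ :=
    ENNReal.lintegral_rpow_add_lt_top_of_lintegral_rpow_lt_top habsV huqV hconst hq1.le
  have hm : ∀ x, max ((u x).toReal - k) 0 ≤ |(u x).toReal| + |k| := fun x =>
    max_le ((le_abs_self _).trans (abs_sub _ _)) (by positivity)
  have hm' : ∀ x, ENNReal.ofReal (max ((u x).toReal - k) 0) ≤ (u x).abs + ENNReal.ofReal |k| := by
    intro x
    refine (ENNReal.ofReal_le_ofReal (hm x)).trans (ENNReal.ofReal_add_le.trans ?_)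
    gcongr
    exact EReal.ofReal_abs_toReal_le _
  have hhV : ∫⁻ x in V, h x ^ q ∂μ < ⊤ := by
    have h1 : ∫⁻ x in V, (ENNReal.ofReal c * ((u x).abs + ENNReal.ofReal |k|)) ^ q ∂μ < ⊤ := by
      simp only [ENNReal.mul_rpow_of_nonneg _ _ hq.le]
      rw [lintegral_const_mul' _ _ (by finiteness)]
      finiteness
    refine lt_of_le_of_lt (lintegral_mono_ae ?_)
      (ENNReal.lintegral_rpow_add_lt_top_of_lintegral_rpow_lt_top
        hgu.1.1.aemeasurable hguV h1 hq1.le)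
    filter_upwards [hnotN] with x hx
    refine ENNReal.rpow_le_rpow ?_ hq.le
    simp only [hh, truncationGradient, indicator_of_notMem hx, add_zero, Pi.add_apply]
    refine add_le_add ?_ ?_
    · refine mul_le_of_le_one_left' (ENNReal.ofReal_le_one.2 ?_)
      split_ifs
      · linarith [hη0 x]
      · norm_num
    · rw [← hUN x hx, ENNReal.ofReal_mul hc]
      gcongr
      exact hm' x
  have hBV : Metric.ball y s ⊆ V := Metric.ball_subset_ball hss'.le
  set E : Set X := Metric.ball y s ∩ {x | k < (u x).toReal} with hE
  -- the test function is admissible on every open set between `E` and the ball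
  have htest : ∀ Ω' : Set X, IsOpen Ω' → E ⊆ Ω' → Ω' ⊆ Metric.ball y s →
      ∫⁻ x in Ω', pqDensity p q (a x) (b x) (gu x) ∂μ ≤
        ENNReal.ofReal K * ∫⁻ x in Ω', pqDensity p q (a x) (b x) (h x) ∂μ := by
    intro Ω' hΩ' hEΩ' hΩ'B
    have hΩ'V : Ω' ⊆ V := hΩ'B.trans hBV
    have hvg : IsWeakUpperGradient q μ Ω' v h :=
      hgu.1.truncation hq hΩ (hΩ'V.trans hVΩ) hgu.2.1 hU hN hUN hηc hη1 hη hc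
    have hhΩ' : ∫⁻ x in Ω', h x ^ q ∂μ < ⊤ := (lintegral_mono_set hΩ'V).trans_lt hhV
    have huΩ' : AEMeasurable u (μ.restrict Ω') :=
      huV.mono_measure (Measure.restrict_mono_set μ hΩ'V)
    have hvm : AEMeasurable v (μ.restrict Ω') := by
      refine measurable_coe_real_ereal.comp_aemeasurable ?_
      exact huΩ'.ereal_toReal.sub
        (hηc.aemeasurable.mul ((huΩ'.ereal_toReal.sub_const k).max aemeasurable_const))
    have hφ : ∀ x, |η x * max ((u x).toReal - k) 0| ≤ max ((u x).toReal - k) 0 := fun x => by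
      rw [abs_of_nonneg (mul_nonneg (hη0 x) (le_max_right _ _))]
      exact mul_le_of_le_one_left (le_max_right _ _) (hη1 x)
    have hvN : MemNewtonian q μ Ω' v := by
      refine ⟨hvm, ?_, h, hvg, hhΩ'⟩
      refine lt_of_le_of_lt ((lintegral_mono fun x => ?_).trans (lintegral_mono_set hΩ'V))
        (ENNReal.lintegral_rpow_add_lt_top_of_lintegral_rpow_lt_top habsV huqV hsum hq1.le)
      refine ENNReal.rpow_le_rpow ?_ hq.le
      simp only [hv, EReal.abs_def]
      refine (ENNReal.ofReal_le_ofReal ((abs_sub _ _).trans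
        (add_le_add_right (hφ x) _))).trans (ENNReal.ofReal_add_le.trans ?_)
      exact add_le_add (EReal.ofReal_abs_toReal_le _) (hm' x)
    have hzero : MemNewtonianZero q μ Ω' (fun x => u x - v x) := by
      have hind : (fun x => if x ∈ Ω' then u x - v x else 0) =
          Ω'.indicator (fun x => u x - v x) := by
        ext x; simp [indicator_apply]
      refine ⟨?_, ?_, _, hgu.1.zeroExtension_truncation hq hΩ hVo
        (Metric.isClosed_closedBall (x := y) (ε := s)) hVΩ
        (Metric.closedBall_subset_ball hss') (hΩ'B.trans Metric.ball_subset_closedBall) hgu.2.1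
        hU hN hUN (k := k) hηc hη1 hη hc ?_, ?_⟩
      · rw [Measure.restrict_univ, hind, aemeasurable_indicator_iff hΩ'.measurableSet]
        simp only [sub_eq_add_neg]
        exact huΩ'.add (continuous_neg.measurable.comp_aemeasurable hvm)
      · rw [Measure.restrict_univ]
        have habs : ∀ x, (if x ∈ Ω' then u x - v x else 0).abs ^ q =
            Ω'.indicator (fun x => (u x - v x).abs ^ q) x := fun x => by
          by_cases hx : x ∈ Ω' <;> simp [hx, hq]
        simp only [habs]
        rw [lintegral_indicator hΩ'.measurableSet]
        refine (lintegral_mono_set hΩ'V).trans_lt (lt_of_le_of_lt (lintegral_mono_ae ?_) hsum)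
        filter_upwards [hufin] with x hx
        refine ENNReal.rpow_le_rpow ?_ hq.le
        rw [EReal.abs_sub_eq_ofReal hx (EReal.abs_coe_lt_top _), EReal.toReal_coe, sub_sub_cancel]
        exact (ENNReal.ofReal_le_ofReal (hφ x)).trans (hm' x)
      · intro x _ hx
        by_cases hxB : x ∈ Metric.ball y s
        · have : ¬ k < (u x).toReal := fun hk => hx (hEΩ' ⟨hxB, hk⟩)
          rw [max_eq_right (by linarith), mul_zero]
        · rw [hsupp x hxB, zero_mul]
      · rw [Measure.restrict_univ]
        have hpow : ∀ x, V.indicator (fun x => gu x + h x) x ^ q =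
            V.indicator (fun x => (gu x + h x) ^ q) x := fun x => by
          by_cases hx : x ∈ V <;> simp [hx, hq]
        simp only [← hh, hpow]
        rw [lintegral_indicator hVo.measurableSet]
        exact ENNReal.lintegral_rpow_add_lt_top_of_lintegral_rpow_lt_top
          hgu.1.1.aemeasurable hguV hhV hq1.le
    -- The minimal gradient only mediates: quasiminimality is stated with it, and minimality bounds
    -- it by the explicit gradient `h`.
    obtain ⟨gv, hgv⟩ := exists_isMinimalWeakUpperGradient hq hΩ' hvg hhΩ'.ne
    have hmain := hu.2 Ω' hΩ' (Metric.isBounded_ball.subset hΩ'B)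
      ((closure_mono (hΩ'V.trans hVK)).trans (Metric.isClosed_closedBall.closure_eq.subset.trans
        hball)) v hvN hzero gu gv hgu hgv
    rw [pqEnergy_eq_lintegral_pqDensity ha hgu.1.1,
      pqEnergy_eq_lintegral_pqDensity ha hgv.1.1] at hmain
    refine hmain.trans (mul_le_mul' le_rfl (lintegral_mono_ae ?_))
    filter_upwards [hgv.2.2 h hvg (.of_lintegral_ne_top hhΩ'.ne)] with x hx
    exact pqDensity_mono (by linarith) hq.le _ _ hx
  -- approximate `E` from outside by open sets
  have hμB : μ (Metric.ball y s) < ⊤ := hμ y s hs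
  have : IsFiniteMeasure (μ.restrict (Metric.ball y s)) := ⟨by simpa using hμB⟩
  have hdens : ∫⁻ x in Metric.ball y s, pqDensity p q (a x) (b x) (h x) ∂μ < ⊤ :=
    lintegral_pqDensity_lt_top (by linarith) hpq.le haβ hbβ hμB
      ((lintegral_mono_set hBV).trans_lt hhV)
  -- The truncation energy as a finite Borel measure is outer regular, which applies to `E` without
  -- Borel measurability.
  let ν := (μ.restrict (Metric.ball y s)).withDensity fun x => pqDensity p q (a x) (b x) (h x)
  have : IsFiniteMeasure ν := isFiniteMeasure_withDensity hdens.ne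
  have hν : ∀ D ⊆ Metric.ball y s, ν D = ∫⁻ x in D, pqDensity p q (a x) (b x) (h x) ∂μ := by
    intro D hD
    rw [withDensity_apply', Measure.restrict_restrict_of_subset hD]
  rw [← hν E inter_subset_left]
  have hlim : ∀ ε : ℝ≥0, 0 < ε →
      ∫⁻ x in E, pqDensity p q (a x) (b x) (gu x) ∂μ ≤ ENNReal.ofReal K * (ν E + ε) := by
    intro ε hε
    obtain ⟨O, hEO, hO, hνO⟩ := E.exists_isOpen_lt_add (μ := ν) (measure_ne_top ν E)
      (ε := ε) (by exact_mod_cast hε.ne')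
    calc ∫⁻ x in E, pqDensity p q (a x) (b x) (gu x) ∂μ
        ≤ ∫⁻ x in O ∩ Metric.ball y s, pqDensity p q (a x) (b x) (gu x) ∂μ :=
          lintegral_mono_set (subset_inter hEO inter_subset_left)
      _ ≤ ENNReal.ofReal K * ν (O ∩ Metric.ball y s) := by
          rw [hν _ inter_subset_right]
          exact htest _ (hO.inter Metric.isOpen_ball) (subset_inter hEO inter_subset_left)
            inter_subset_right
      _ ≤ _ := by
          gcongr
          exact (measure_mono inter_subset_left).trans hνO.le
  refine ge_of_tendsto (x := 𝓝[>] (0 : ℝ≥0)) (f := fun ε : ℝ≥0 => ENNReal.ofReal K * (ν E + ε))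
    ?_ (eventually_mem_nhdsWithin.mono fun ε hε => hlim ε hε)
  have hcont : Continuous fun ε : ℝ≥0 => ENNReal.ofReal K * (ν E + ε) :=
    (ENNReal.continuous_const_mul ENNReal.ofReal_ne_top).comp
      (continuous_const.add ENNReal.continuous_coe)
  have := hcont.tendsto 0
  simp only [ENNReal.coe_zero, add_zero] at this
  exact this.mono_left nhdsWithin_le_nhds

end EnergyComparison

/-! ### The cutoff and hole filling. -/

theorem abs_cutoff_sub_le {X : Type*} [MetricSpace X] (y : X) {t s : ℝ} (hts : t < s) (x z : X) :
    |max 0 (min 1 ((s - dist x y) / (s - t))) - max 0 (min 1 ((s - dist z y) / (s - t)))| ≤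
      1 / (s - t) * dist x z := by
  have h0 : 0 < s - t := sub_pos.2 hts
  rw [max_comm 0, max_comm 0]
  refine (abs_max_sub_max_le_abs _ _ _).trans ?_
  rw [min_comm 1, min_comm 1]
  refine (abs_min_sub_min_le_max _ _ _ _).trans ?_
  rw [sub_self, abs_zero, max_eq_left (abs_nonneg _), ← sub_div, abs_div, abs_of_pos h0,
    sub_sub_sub_cancel_left, one_div, div_eq_inv_mul, abs_sub_comm]
  gcongr
  exact abs_dist_sub_le x z y

theorem pqDensity_zero {p q : ℝ} (hp : 0 < p) (hq : 0 < q) (a b : ℝ) : pqDensity p q a b 0 = 0 := by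
  simp [pqDensity, hp, hq]

theorem pqDensity_ofReal_mul {p q : ℝ} (hp : 0 < p) (hq : 0 < q) (a b : ℝ) {c m : ℝ} (hc : 0 ≤ c) :
    pqDensity p q a b (ENNReal.ofReal (c * m)) =
      ENNReal.ofReal (c ^ p) * (ENNReal.ofReal a * ENNReal.ofReal m ^ p) +
      ENNReal.ofReal (c ^ q) * (ENNReal.ofReal b * ENNReal.ofReal m ^ q) := by
  rw [pqDensity, ENNReal.ofReal_mul hc, ENNReal.mul_rpow_of_nonneg _ _ hp.le,
    ENNReal.mul_rpow_of_nonneg _ _ hq.le, ENNReal.ofReal_rpow_of_nonneg hc hp.le,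
    ENNReal.ofReal_rpow_of_nonneg hc hq.le]
  ring

/-- Hole filling, in terms of a Borel representative `U` of the quasiminimizer. -/
theorem IsQuasiminimizer.hole_filling {X : Type*} [MetricSpace X] [ProperSpace X]
    [MeasurableSpace X] [BorelSpace X] {p q K β : ℝ} (hp : 1 < p) (hpq : p < q) {μ : Measure X}
    (hμ : ∀ (x : X) (r : ℝ), 0 < r → μ (Metric.ball x r) < ⊤)
    {Ω : Set X} (hΩ : IsOpen Ω) {a b : X → ℝ} (ha : AEMeasurable a μ) (hb : AEMeasurable b μ)
    (haβ : ∀ x, a x ≤ β) (hbβ : ∀ x, b x ≤ β) {u : X → EReal}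
    (hu : IsQuasiminimizer p q K μ a b Ω u) {gu : X → ℝ≥0∞}
    (hgu : IsMinimalWeakUpperGradient q μ Ω u gu) {y : X} {t s s' : ℝ} (ht : 0 < t) (hts : t < s)
    (hss' : s < s') (hball : Metric.closedBall y s' ⊆ Ω) {U : X → ℝ} (hU : Measurable U)
    {N : Set X} (hN : MeasurableSet N) (hN0 : μ (N ∩ Ω) = 0)
    (hUN : ∀ x, x ∉ N → (u x).toReal = U x) {k : ℝ} :
    (1 + ENNReal.ofReal K * 2 ^ q) *
        ∫⁻ x in Metric.ball y t ∩ {x | k < U x}, pqDensity p q (a x) (b x) (gu x) ∂μ ≤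
      ENNReal.ofReal K * 2 ^ q *
        (∫⁻ x in Metric.ball y s ∩ {x | k < U x}, pqDensity p q (a x) (b x) (gu x) ∂μ +
          (ENNReal.ofReal (1 / (s - t) ^ p) *
              ∫⁻ x in Metric.ball y s ∩ {x | k < U x},
                ENNReal.ofReal (a x) * ENNReal.ofReal (U x - k) ^ p ∂μ +
            ENNReal.ofReal (1 / (s - t) ^ q) *
              ∫⁻ x in Metric.ball y s ∩ {x | k < U x},
                ENNReal.ofReal (b x) * ENNReal.ofReal (U x - k) ^ q ∂μ)) := by
  have hp0 : 0 < p := by linarith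
  have hq0 : 0 < q := by linarith
  have hst : 0 < s - t := sub_pos.2 hts
  have hs : 0 < s := ht.trans hts
  set T : ℝ → Set X := fun r => Metric.ball y r ∩ {x | k < U x} with hT
  have hTm : ∀ r, MeasurableSet (T r) := fun r =>
    Metric.isOpen_ball.measurableSet.inter (measurableSet_lt measurable_const hU)
  have hTts : T t ⊆ T s := inter_subset_inter_left _ (Metric.ball_subset_ball hts.le)
  set η : X → ℝ := fun x => max 0 (min 1 ((s - dist x y) / (s - t))) with hη
  have hηm : Measurable η := by
    refine Continuous.measurable ?_
    fun_prop
  have hη0 : ∀ x, 0 ≤ η x := fun x => le_max_left _ _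
  have hη1 : ∀ x, η x ≤ 1 := fun x => max_le zero_le_one (min_le_left _ _)
  have hηt : ∀ x ∈ Metric.ball y t, η x = 1 := by
    intro x hx
    have : 1 ≤ (s - dist x y) / (s - t) := by
      rw [one_le_div hst]
      linarith [Metric.mem_ball.1 hx]
    rw [hη]
    simp only [min_eq_left this, max_eq_right zero_le_one]
  have hηs : ∀ x, x ∉ Metric.ball y s → η x = 0 := by
    intro x hx
    rw [Metric.mem_ball, not_lt] at hx
    have : (s - dist x y) / (s - t) ≤ 0 := div_nonpos_of_nonpos_of_nonneg (by linarith) hst.le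
    exact max_eq_left ((min_le_right _ _).trans this)
  have hc : 0 ≤ 1 / (s - t) := by positivity
  have hmain := hu.lintegral_pqDensity_le_truncation hp hpq hμ hΩ ha haβ hbβ hgu hs hss' hball hU
    hN hN0 hUN (k := k) hηm hη0 hη1 (fun x z => abs_cutoff_sub_le y hts x z) hc hηs
  have hae : ∀ᵐ x ∂μ, x ∈ Ω → x ∉ N := by
    rw [ae_iff]
    refine measure_mono_null (fun x hx => ?_) hN0
    simp only [mem_ofPred_eq, Classical.not_imp, not_not] at hx
    exact ⟨hx.2, hx.1⟩
  have hBΩ : Metric.ball y s ⊆ Ω :=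
    (Metric.ball_subset_ball hss'.le).trans (Metric.ball_subset_closedBall.trans hball)
  have hset : (Metric.ball y s ∩ {x | k < (u x).toReal} : Set X) =ᵐ[μ] T s := by
    filter_upwards [hae] with x hx
    refine propext (and_congr_right fun hxs => ?_)
    change k < (u x).toReal ↔ k < U x
    rw [hUN x (hx (hBΩ hxs))]
  rw [setLIntegral_congr hset, setLIntegral_congr hset] at hmain
  set D := ∫⁻ x in T s \ T t, pqDensity p q (a x) (b x) (gu x) ∂μ with hD
  set Y := ENNReal.ofReal (1 / (s - t) ^ p) *
      (∫⁻ x in T s, ENNReal.ofReal (a x) * ENNReal.ofReal (U x - k) ^ p ∂μ) +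
    ENNReal.ofReal (1 / (s - t) ^ q) *
      ∫⁻ x in T s, ENNReal.ofReal (b x) * ENNReal.ofReal (U x - k) ^ q ∂μ with hY
  have hsplit : ∫⁻ x in T s, pqDensity p q (a x) (b x) (gu x) ∂μ =
      (∫⁻ x in T t, pqDensity p q (a x) (b x) (gu x) ∂μ) + D := by
    rw [← lintegral_inter_add_sdiff _ (T s) (hTm t), inter_eq_self_of_subset_right hTts]
  have hgm : Measurable gu := hgu.1.1
  have hh : ∫⁻ x in T s, pqDensity p q (a x) (b x)
      (truncationGradient U η gu N k (1 / (s - t)) x) ∂μ ≤ 2 ^ q * (D + Y) := by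
    have hDY : D + Y = ∫⁻ x in T s, ((T t)ᶜ.indicator
        (fun x => pqDensity p q (a x) (b x) (gu x)) x +
        pqDensity p q (a x) (b x) (ENNReal.ofReal (1 / (s - t) * (U x - k)))) ∂μ := by
      rw [lintegral_add_left' ((ha.pqDensity hb hgm.aemeasurable).restrict.indicator (hTm t).compl),
        lintegral_indicator (hTm t).compl, Measure.restrict_restrict (hTm t).compl, inter_comm,
        ← sdiff_eq]
      congr 1
      simp only [pqDensity_ofReal_mul hp0 hq0 _ _ hc, Real.div_rpow zero_le_one hst.le,
        Real.one_rpow]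
      rw [lintegral_add_left', lintegral_const_mul' _ _ ENNReal.ofReal_ne_top,
        lintegral_const_mul' _ _ ENNReal.ofReal_ne_top]
      exact ((ha.ennreal_ofReal.mul
        ((hU.sub_const k).ennreal_ofReal.pow_const p).aemeasurable).const_mul _).restrict
    rw [hDY, ← lintegral_const_mul' _ _ (by finiteness)]
    refine setLIntegral_mono_ae' (hTm s) ?_
    filter_upwards [hae] with x hx hxs
    have hxN : x ∉ N := hx (hBΩ hxs.1)
    have hkx : k < U x := hxs.2
    -- On `T t` the cutoff equals 1 and removes the `gu` term; only the part outside `T t` keeps it.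
    have hle : truncationGradient U η gu N k (1 / (s - t)) x ≤
        (T t)ᶜ.indicator gu x + ENNReal.ofReal (1 / (s - t) * (U x - k)) := by
      simp only [truncationGradient, indicator_of_notMem hxN, add_zero, if_pos hkx,
        max_eq_left (sub_nonneg.2 hkx.le)]
      gcongr
      by_cases hxt : x ∈ T t
      · simp [hηt x hxt.1]
      · rw [indicator_of_mem (mem_compl hxt)]
        exact mul_le_of_le_one_left' (ENNReal.ofReal_le_one.2 (by linarith [hη0 x]))
    refine (pqDensity_mono hp0.le hq0.le _ _ hle).trans
      ((pqDensity_add_le hp.le hpq.le _ _ _ _).trans (le_of_eq ?_))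
    congr 2
    by_cases hxt : x ∈ T t
    · simp [hxt, pqDensity_zero hp0 hq0]
    · simp [hxt]
  rw [hsplit] at hmain ⊢
  -- Adding the energy on the hole `T t` completes the integral over `T s \ T t` to one over `T s`.
  calc (1 + ENNReal.ofReal K * 2 ^ q) * ∫⁻ x in T t, pqDensity p q (a x) (b x) (gu x) ∂μ
      = (∫⁻ x in T t, pqDensity p q (a x) (b x) (gu x) ∂μ) + ENNReal.ofReal K * 2 ^ q *
          ∫⁻ x in T t, pqDensity p q (a x) (b x) (gu x) ∂μ := by ring
    _ ≤ ENNReal.ofReal K * (2 ^ q * (D + Y)) + ENNReal.ofReal K * 2 ^ q *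
          ∫⁻ x in T t, pqDensity p q (a x) (b x) (gu x) ∂μ := by
        gcongr
        exact (le_self_add.trans hmain).trans (by gcongr)
    _ = _ := by ring

/-! ### Conclusion of the proof. -/

theorem setLIntegral_superlevelSet_eq {X : Type*} [MetricSpace X] [MeasurableSpace X]
    {μ : Measure X} {Ω : Set X} {u : X → EReal} {U : X → ℝ} {y : X} {k r : ℝ} {f f' : X → ℝ≥0∞}
    (hm : MeasurableSet (Metric.ball y r ∩ {x | k < U x})) (hr : Metric.ball y r ⊆ Ω)
    (hae : ∀ᵐ x ∂μ, x ∈ Metric.ball y r → u x = (U x : EReal))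
    (hf : ∀ x, u x = (U x : EReal) → f x = f' x) :
    ∫⁻ x in superlevelSet Ω u y k r, f x ∂μ =
      ∫⁻ x in Metric.ball y r ∩ {x | k < U x}, f' x ∂μ := by
  have hset : superlevelSet Ω u y k r =ᵐ[μ] (Metric.ball y r ∩ {x | k < U x} : Set X) := by
    filter_upwards [hae] with x hx
    refine propext ⟨fun h => ⟨h.1.1, ?_⟩, fun h => ⟨⟨h.1, hr h.1⟩, ?_⟩⟩
    · have := h.2
      rwa [hx h.1.1, EReal.coe_lt_coe_iff] at this
    · rw [hx h.1, EReal.coe_lt_coe_iff]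
      exact h.2
  rw [setLIntegral_congr hset]
  refine setLIntegral_congr_fun_ae hm ?_
  filter_upwards [hae] with x hx hmem
  exact hf x (hx hmem.1)

theorem lemma4p1 (p q K : ℝ) (hp : 1 < p) (hpq : p < q) (hK : 1 ≤ K) :
    ∃ C : ℝ, 0 < C ∧
      ∀ (X : Type*) [MetricSpace X] [CompleteSpace X] [MeasurableSpace X] [BorelSpace X]
        (μ : Measure X), DoublingMeasure μ →
      ∀ (Ω : Set X), IsOpen Ω → Ω.Nonempty → 0 < μ Ωᶜ →
      ∀ (a b : X → ℝ) (α β : ℝ), AEMeasurable a μ → AEMeasurable b μ → 0 < α →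
        (∀ x, α ≤ a x ∧ a x ≤ β) → (∀ x, α ≤ b x ∧ b x ≤ β) →
      ∀ (u : X → EReal), IsQuasiminimizer p q K μ a b Ω u →
      ∀ (gu : X → ℝ≥0∞), IsMinimalWeakUpperGradient q μ Ω u gu →
      ∀ y ∈ Ω, ∀ ρ R : ℝ, 0 < ρ → ρ < R → R < Metric.infDist y Ωᶜ / 2 →
      ∀ k : ℝ,
        ∫⁻ x in superlevelSet Ω u y k ρ,
            (ENNReal.ofReal (a x) * gu x ^ p + ENNReal.ofReal (b x) * gu x ^ q) ∂μ
          ≤ ENNReal.ofReal C *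
            (ENNReal.ofReal (1 / (R - ρ) ^ p) *
                ∫⁻ x in superlevelSet Ω u y k R,
                  ENNReal.ofReal (a x) * (u x - (k : EReal)).toENNReal ^ p ∂μ
              + ENNReal.ofReal (1 / (R - ρ) ^ q) *
                ∫⁻ x in superlevelSet Ω u y k R,
                  ENNReal.ofReal (b x) * (u x - (k : EReal)).toENNReal ^ q ∂μ) := by
  have hp0 : 0 < p := by linarith
  have hq0 : 0 < q := by linarith
  -- `K` comes from quasiminimality and `2 ^ q` from splitting the energy density of a sum.
  set M : ℝ := K * 2 ^ q with hM
  have hM0 : 0 < M := by positivity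
  obtain ⟨C, hC0, hC⟩ := exists_const_of_absorption (θ := M / (1 + M)) hp0 hpq.le (by positivity)
    (by rw [div_lt_one (by linarith)]; linarith)
  refine ⟨C, hC0, ?_⟩
  intro X _ _ _ _ μ hμ Ω hΩ _ hΩc a b α β ha hb _ haβ hbβ u hu gu hgu y hy ρ R hρ hρR hR k
  have := hμ.properSpace
  have hμfin : ∀ (x : X) (r : ℝ), 0 < r → μ (Metric.ball x r) < ⊤ := by
    obtain ⟨_, _, h⟩ := hμ
    exact fun x r hr => (h x r hr).2.2
  -- This radius leaves room beyond `R`. It is positive because `0 < ρ < R < s'`, so a point of the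
  -- closed ball outside `Ω` would be closer to `y` than the distance to the complement.
  set s' := Metric.infDist y Ωᶜ / 2 with hs'
  have hs'0 : 0 < s' := hρ.trans (hρR.trans hR)
  have hball : Metric.closedBall y s' ⊆ Ω := by
    intro x hx
    by_contra hxΩ
    have h1 := Metric.infDist_le_dist_of_mem (x := y) (mem_compl hxΩ)
    rw [Metric.mem_closedBall, dist_comm] at hx
    linarith
  have hFm : AEMeasurable (fun x => (u x).toReal) (μ.restrict Ω) := hu.1.1.ereal_toReal
  set U : X → ℝ := hFm.mk _ with hU
  have hUm : Measurable U := hFm.measurable_mk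
  set N : Set X := toMeasurable (μ.restrict Ω) {x | (u x).toReal ≠ U x} with hN
  have hNm : MeasurableSet N := measurableSet_toMeasurable _ _
  have hN0 : μ (N ∩ Ω) = 0 := by
    rw [← Measure.restrict_apply hNm, hN, measure_toMeasurable]
    exact hFm.ae_eq_mk
  have hUN : ∀ x, x ∉ N → (u x).toReal = U x := fun x hx => by
    by_contra hne
    exact hx (subset_toMeasurable _ _ hne)
  have haβ' : ∀ x, a x ≤ β := fun x => (haβ x).2
  have hbβ' : ∀ x, b x ≤ β := fun x => (hbβ x).2
  have hfin : ∀ᵐ x ∂μ.restrict (Metric.closedBall y s'), (u x).abs < ⊤ :=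
    ae_abs_lt_top hq0 (hu.1.1.mono_measure (Measure.restrict_mono_set μ hball))
      (hu.1.2.1.lintegral_lt_top_of_isCompact hΩ (isCompact_closedBall y s') hball).ne
  rw [ae_restrict_iff' Metric.isClosed_closedBall.measurableSet] at hfin
  have hUae : ∀ᵐ x ∂μ, x ∈ Metric.closedBall y s' → u x = (U x : EReal) := by
    have hae : ∀ᵐ x ∂μ, x ∈ Ω → (u x).toReal = U x :=
      (ae_restrict_iff' hΩ.measurableSet).1 hFm.ae_eq_mk
    filter_upwards [hae, hfin] with x hx1 hx2 hx
    rw [← hx1 (hball hx), EReal.coe_toReal_of_abs_lt_top (hx2 hx)]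
  have hcong : ∀ r < s', ∀ f f' : X → ℝ≥0∞, (∀ x, u x = (U x : EReal) → f x = f' x) →
      ∫⁻ x in superlevelSet Ω u y k r, f x ∂μ =
        ∫⁻ x in Metric.ball y r ∩ {x | k < U x}, f' x ∂μ := by
    intro r hr f f' hf
    have hsub : Metric.ball y r ⊆ Metric.closedBall y s' :=
      Metric.ball_subset_closedBall.trans (Metric.closedBall_subset_closedBall hr.le)
    refine setLIntegral_superlevelSet_eq (Metric.isOpen_ball.measurableSet.inter
      (measurableSet_lt measurable_const hUm)) (hsub.trans hball) ?_ hf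
    filter_upwards [hUae] with x hx hmem
    exact hx (hsub hmem)
  have hsub : ∀ x, u x = (U x : EReal) → (u x - (k : EReal)).toENNReal = ENNReal.ofReal (U x - k) :=
    fun x hx => by rw [hx, ← EReal.coe_sub, EReal.real_coe_toENNReal]
  rw [hcong ρ (hρR.trans hR)
      (fun x => ENNReal.ofReal (a x) * gu x ^ p + ENNReal.ofReal (b x) * gu x ^ q)
      (fun x => pqDensity p q (a x) (b x) (gu x)) (fun _ _ => rfl),
    hcong R hR _ (fun x => ENNReal.ofReal (a x) * ENNReal.ofReal (U x - k) ^ p)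
      (fun x hx => by rw [hsub x hx]),
    hcong R hR _ (fun x => ENNReal.ofReal (b x) * ENNReal.ofReal (U x - k) ^ q)
      (fun x hx => by rw [hsub x hx])]
  set Ψ : ℝ → ℝ≥0∞ := fun r =>
    ∫⁻ x in Metric.ball y r ∩ {x | k < U x}, pqDensity p q (a x) (b x) (gu x) ∂μ with hΨ
  set A := ∫⁻ x in Metric.ball y R ∩ {x | k < U x},
    ENNReal.ofReal (a x) * ENNReal.ofReal (U x - k) ^ p ∂μ with hA
  set B := ∫⁻ x in Metric.ball y R ∩ {x | k < U x},
    ENNReal.ofReal (b x) * ENNReal.ofReal (U x - k) ^ q ∂μ with hB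
  have hd : ∀ {t s r : ℝ}, t < s → 0 < 1 / (s - t) ^ r := fun h =>
    one_div_pos.2 (Real.rpow_pos_of_pos (sub_pos.2 h) _)
  have hC' : ENNReal.ofReal C ≠ 0 := (ENNReal.ofReal_pos.2 hC0).ne'
  by_cases hAt : A = ⊤
  · rw [hAt, ENNReal.mul_top (ENNReal.ofReal_pos.2 (hd hρR)).ne', top_add, ENNReal.mul_top hC']
    exact le_top
  by_cases hBt : B = ⊤
  · rw [hBt, ENNReal.mul_top (ENNReal.ofReal_pos.2 (hd hρR)).ne', add_top, ENNReal.mul_top hC']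
    exact le_top
  have hmono : ∀ {r r' : ℝ}, r ≤ r' → Ψ r ≤ Ψ r' := fun h =>
    lintegral_mono_set (inter_subset_inter_left _ (Metric.ball_subset_ball h))
  -- Absorption needs the energy to be finite beforehand; this also permits the passage to real
  -- numbers.
  have hΨR : Ψ R < ⊤ := by
    have hsub' : Metric.ball y R ⊆ Metric.closedBall y s' :=
      Metric.ball_subset_closedBall.trans (Metric.closedBall_subset_closedBall hR.le)
    refine (lintegral_mono_set inter_subset_left).trans_lt (lintegral_pqDensity_lt_top hp0.le
      hpq.le haβ' hbβ' (hμfin y R (hρ.trans hρR)) ((lintegral_mono_set hsub').trans_lt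
        (hgu.2.1.lintegral_lt_top_of_isCompact hΩ (isCompact_closedBall y s') hball)))
  have hΨfin : ∀ r ≤ R, Ψ r ≠ ⊤ := fun r hr => ((hmono hr).trans_lt hΨR).ne
  have hMof : ENNReal.ofReal K * 2 ^ q = ENNReal.ofReal M := by
    rw [hM, ENNReal.ofReal_mul (by linarith), ← ENNReal.ofReal_rpow_of_pos two_pos,
      ENNReal.ofReal_ofNat]
  have hfinal := hC (fun r => (Ψ r).toReal) ρ R A.toReal B.toReal (Ψ R).toReal hρR
    ENNReal.toReal_nonneg ENNReal.toReal_nonneg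
    (fun t _ ht => ⟨ENNReal.toReal_nonneg, ENNReal.toReal_mono hΨR.ne (hmono ht)⟩) ?_
  · have hRp := (hd hρR : 0 < 1 / (R - ρ) ^ p).le
    have hRq := (hd hρR : 0 < 1 / (R - ρ) ^ q).le
    change Ψ ρ ≤ _
    rw [← ENNReal.ofReal_toReal (hΨfin ρ hρR.le), ← ENNReal.ofReal_toReal hAt,
      ← ENNReal.ofReal_toReal hBt, ← ENNReal.ofReal_mul hRp, ← ENNReal.ofReal_mul hRq,
      ← ENNReal.ofReal_add (by positivity) (by positivity), ← ENNReal.ofReal_mul hC0.le]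
    refine ENNReal.ofReal_le_ofReal (hfinal.trans (le_of_eq ?_))
    ring
  · intro t s ht hts hsR
    have hstep := hu.hole_filling hp hpq hμfin hΩ ha hb haβ' hbβ' hgu (hρ.trans_le ht) hts
      (hsR.trans_lt hR) hball hUm hNm hN0 hUN (k := k)
    have hTs : Metric.ball y s ∩ {x | k < U x} ⊆ Metric.ball y R ∩ {x | k < U x} :=
      inter_subset_inter_left _ (Metric.ball_subset_ball hsR)
    have hstep' : (1 + ENNReal.ofReal M) * Ψ t ≤ ENNReal.ofReal M *
        (Ψ s + (ENNReal.ofReal (1 / (s - t) ^ p) * A + ENNReal.ofReal (1 / (s - t) ^ q) * B)) := by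
      rw [← hMof]
      refine hstep.trans ?_
      gcongr
      exacts [lintegral_mono_set hTs, lintegral_mono_set hTs]
    have hreal := ENNReal.toReal_mono (by
      have := hΨfin s hsR
      finiteness) hstep'
    have hΨs := hΨfin s hsR
    have h1p := (hd hts : 0 < 1 / (s - t) ^ p).le
    have h1q := (hd hts : 0 < 1 / (s - t) ^ q).le
    rw [ENNReal.toReal_mul, ENNReal.toReal_mul, ENNReal.toReal_add (by finiteness) (by finiteness),
      ENNReal.toReal_add (by finiteness) (by finiteness),
      ENNReal.toReal_add (by finiteness) (by finiteness), ENNReal.toReal_mul, ENNReal.toReal_mul,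
      ENNReal.toReal_ofReal hM0.le, ENNReal.toReal_ofReal h1p, ENNReal.toReal_ofReal h1q,
      ENNReal.toReal_one] at hreal
    have hθ : M / (1 + M) ≤ 1 := by
      rw [div_le_one (by linarith)]
      linarith
    set Y := 1 / (s - t) ^ p * A.toReal + 1 / (s - t) ^ q * B.toReal with hY
    have hY0 : 0 ≤ Y := add_nonneg (mul_nonneg h1p ENNReal.toReal_nonneg)
      (mul_nonneg h1q ENNReal.toReal_nonneg)
    calc (Ψ t).toReal ≤ M * ((Ψ s).toReal + Y) / (1 + M) := by
          rw [le_div_iff₀ (by linarith)]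
          linarith
      _ = M / (1 + M) * (Ψ s).toReal + M / (1 + M) * Y := by ring
      _ ≤ M / (1 + M) * (Ψ s).toReal + 1 * Y := by gcongr
      _ = _ := by rw [hY]; ring
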